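/- **Setting.** Let $\mathbb T^3=[0,2\pi]^3$ be the standard torus with coordinates $x_1,x_2,x_3$, let $\nu>0$, $\alpha\ge 0$, and let $s\ge 1$ be an integer. For $\lambda>0$ let $f_s=\Bigl(\tfrac{1}{\sqrt2\,\pi}\nu^2\lambda s^2\sin sx_3,\,0,\,0\Bigr)$, $\vec v_0=(v_0,0,0)$, $v_0=\tfrac{1}{\sqrt2\,\pi}\nu\lambda\sin sx_3$, $u_0=(I-\alpha^2\Delta)^{-1}v_0=\frac{v_0}{1+\alpha^2s^2}$, $\vec u_0=(u_0,0,0)$. Consider the linear evolution equation $\partial_t\omega+L_3\omega=0$, $L_3\omega=u_0\frac{\partial\bar\omega}{\partial x_1}+\bar\omega_3\frac{\partial u_0}{\partial x_3}e_1-\nu\Delta\omega+\nabla q$, $\operatorname{div}\omega=0$, $\int_{\mathbb T^3}\omega\,dx=0$, $\bar\omega=(I-\alpha^2\Delta)^{-1}\omega$. An *unstable solution with wave numbers $a,b\in\mathbb Z$ and vertical class $r\in\mathbb Z$* is a nonzero smooth (complex-valued) $2\pi$-periodic solution of the form $\omega=(\omega_1(x_3),\omega_2(x_3),\omega_3(x_3))^Te^{i(ax_1+bx_2-act)}$,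 $q=q(x_3)e^{i(ax_1+bx_2-act)}$, $\operatorname{Re}(iac)<0$, in which $\omega_1,\omega_2,\omega_3,q$ have all their Fourier frequencies in $r+s\mathbb Z$; thus $\omega|_{t=0}$ is an eigenfunction of $L_3$ with eigenvalue $iac$. For $0<\delta<1/\sqrt3$ let $A(\delta)=A_s(\delta)$ be the set of real $(t',r)$ with $t'^2+r^2<\tfrac{s^2}{3}$, $t'^2+(-s+r)^2>s^2$, $t'^2+(s+r)^2>s^2$, $t'\ge\delta s$, $-\tfrac s6<r<\tfrac s6$. **Theorem.** Fix $\delta\in(0,1/\sqrt3)$ and constants $c_2>0$, $0<c_3<c_4$ such that the rectangle $\{c_3s\le t'\le c_4s,\ |r|\le c_2s\}$ lies in $A_s(\delta)$ (this condition does not depend on the scale $s>0$), and let $c_1\ge \dfrac{110\sqrt5\,\pi}{63\,\delta^2}$. Put $\lambda=\lambda(s)=\sqrt2\,c_1\,s\,(1+\alpha^2s^2)^2$. 1. For all $\nu>0$, $\alpha\ge0$ and integers $s\ge1$, the flow $\vec v_0$ (with filtered velocity $\vec u_0$ and constant pressure) is a stationary solution of the modified Leray-$\alpha$ equation $-\nu\Delta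 v+(v\cdot\nabla)u+\nabla p=f_s$, $\operatorname{div}u=\operatorname{div}v=0$, $v=u-\alpha^2\Delta u$; and for every triple of integers $(a,b,r)$ with $c_3s\le\sqrt{a^2+b^2}\le c_4s$, $|r|\le c_2s$, $|b|\le a$, the linear equation above has an unstable solution with wave numbers $a,b$ and vertical class $r$. 2. The number $N(s)$ of these triples is finite and, with $c_5=\tfrac14\pi c_2(c_4^2-c_3^2)$, $N(s)/s^3\to 2c_5$ as $s\to\infty$. -/

import Mathlib

open Filter Topology MeasureTheory

noncomputable section

namespace ModifiedLerayAlpha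

/-- Three-dimensional space. Functions on the torus `𝕋³ = [0,2π]³` are represented by functions on
it which are `2π`-periodic in each coordinate. The coordinates `x₁, x₂, x₃` are
`x 0, x 1, x 2`. -/
abbrev E3 : Type := EuclideanSpace ℝ (Fin 3)

section General

variable {F : Type*} [NormedAddCommGroup F] [NormedSpace ℝ F]

/-- A smooth function on the torus `𝕋³`. -/
def IsSmoothOnTorus (g : E3 → F) : Prop :=
  ContDiff ℝ ((⊤ : ℕ∞) : WithTop ℕ∞) g ∧
    ∀ (j : Fin 3) (x : E3), g (x + EuclideanSpace.single j (2 * Real.pi)) = g x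

/-- The partial derivative `∂g/∂x_j`. -/
def pd (j : Fin 3) (g : E3 → F) (x : E3) : F :=
  fderiv ℝ g x (EuclideanSpace.single j (1 : ℝ))

/-- `gbar = (I - α²Δ)⁻¹ g` on the torus: `gbar` is the (unique) smooth periodic solution of
`gbar - α² Δ gbar = g`. -/
def IsFilterOf (α : ℝ) (g gbar : E3 → F) : Prop :=
  IsSmoothOnTorus gbar ∧ ∀ x, gbar x - α ^ 2 • Laplacian.laplacian gbar x = g x

end General

/-- `(v, u, p)` is a (classical) stationary solution of the modified Leray-alpha equation on the
torus with viscosity `ν` and right-hand side `f`: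
`-ν Δv + (v·∇)u + ∇p = f`, `div u = div v = 0`, `v = (I - α²Δ)u`. -/
structure IsStationarySolution (ν α : ℝ) (f v u : Fin 3 → E3 → ℝ) (p : E3 → ℝ) : Prop where
  smooth_v : ∀ j, IsSmoothOnTorus (v j)
  smooth_p : IsSmoothOnTorus p
  filter : ∀ j, IsFilterOf α (v j) (u j)
  momentum : ∀ j x, -ν * Laplacian.laplacian (v j) x + (∑ k, v k x * pd k (u j) x) + pd j p x = f j x
  div_v : ∀ x, ∑ j, pd j (v j) x = 0
  div_u : ∀ x, ∑ j, pd j (u j) x = 0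

/-- The forcing `f_s = ((√2 π)⁻¹ ν² lam s² sin (s x₃), 0, 0)`. -/
def forcing (ν lam : ℝ) (s : ℕ) (j : Fin 3) (x : E3) : ℝ :=
  if j = 0 then 1 / (√2 * Real.pi) * ν ^ 2 * lam * (s : ℝ) ^ 2 * Real.sin (s * x 2) else 0

/-- The first component `v₀ = (√2 π)⁻¹ ν lam sin (s x₃)` of the stationary flow `(v₀, 0, 0)`. -/
def v0 (ν lam : ℝ) (s : ℕ) (x : E3) : ℝ :=
  1 / (√2 * Real.pi) * ν * lam * Real.sin (s * x 2)

/-- The first component `u₀ = (I - α²Δ)⁻¹ v₀ = v₀ / (1 + α² s²)` of the filtered stationary flow. -/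
def u0 (ν α lam : ℝ) (s : ℕ) (x : E3) : ℝ :=
  v0 ν lam s x / (1 + α ^ 2 * (s : ℝ) ^ 2)

/-- The vector field `(g, 0, 0)`. -/
def alongFirst (g : E3 → ℝ) (j : Fin 3) (x : E3) : ℝ :=
  if j = 0 then g x else 0

/-- The `j`-th component at `x` of
`L₃ ω = U ∂ω̄/∂x₁ + ω̄₃ (∂U/∂x₃) e₁ - ν Δω + ∇q`, where `ωbar` stands for `ω̄`. -/
def L3 (ν : ℝ) (U : E3 → ℝ) (ω ωbar : Fin 3 → E3 → ℂ) (q : E3 → ℂ) (j : Fin 3) (x : E3) : ℂ :=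
  (U x : ℂ) * pd 0 (ωbar j) x + (if j = 0 then ωbar 2 x * ((pd 2 U x : ℝ) : ℂ) else 0)
    - (ν : ℂ) * Laplacian.laplacian (ω j) x + pd j q x

/-- The phase space of the linearized problem: smooth vector fields on the torus with zero
divergence and zero mean. -/
structure IsAdmissible (ω : Fin 3 → E3 → ℂ) : Prop where
  smooth : ∀ j, IsSmoothOnTorus (ω j)
  div_eq_zero : ∀ x, ∑ j, pd j (ω j) x = 0
  mean_eq_zero : ∀ j, ∫ x in {x : E3 | ∀ i, x i ∈ Set.Icc 0 (2 * Real.pi)}, ω j x = 0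

/-- `ω` is an eigenfunction, with eigenvalue `μ` and pressure `q`, of the operator `L₃`
in which `ω̄ = (I - α²Δ)⁻¹ ω`. -/
def IsEigenfunction (ν α : ℝ) (U : E3 → ℝ) (μ : ℂ) (ω : Fin 3 → E3 → ℂ) (q : E3 → ℂ) : Prop :=
  IsAdmissible ω ∧ ω ≠ 0 ∧ IsSmoothOnTorus q ∧
    ∃ ωbar : Fin 3 → E3 → ℂ, (∀ j, IsFilterOf α (ω j) (ωbar j)) ∧
      ∀ j x, L3 ν U ω ωbar q j x = μ * ω j x

/-- `(ω, q)` solves the linearized evolution equation `∂ₜω + L₃ ω = 0` with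
`ω̄ = (I - α²Δ)⁻¹ ω`. -/
def IsLinearizedSolution (ν α : ℝ) (U : E3 → ℝ) (ω : ℝ → Fin 3 → E3 → ℂ) (q : ℝ → E3 → ℂ) :
    Prop :=
  (∀ t, IsAdmissible (ω t)) ∧ (∀ t, IsSmoothOnTorus (q t)) ∧
    ∃ ωbar : ℝ → Fin 3 → E3 → ℂ, (∀ t j, IsFilterOf α (ω t j) (ωbar t j)) ∧
      ∀ t j x, HasDerivAt (fun τ => ω τ j x) (-L3 ν U (ω t) (ωbar t) (q t) j x) t

/-- The scalar mode `g(x₃) e^{i(a x₁ + b x₂ - a c t)}`. -/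
def mode (a b : ℤ) (c : ℂ) (g : ℝ → ℂ) (t : ℝ) (x : E3) : ℂ :=
  g (x 2) * Complex.exp (Complex.I * (a * (x 0 : ℂ) + b * (x 1 : ℂ) - a * c * t))

/-- The linearized problem has an unstable solution with wave numbers `a, b` and vertical
wave numbers in `r + sℤ`: a nonzero solution
`ω = (W₁(x₃), W₂(x₃), W₃(x₃)) e^{i(a x₁ + b x₂ - a c t)}`, `q = Q(x₃) e^{i(a x₁ + b x₂ - a c t)}`
with `Re (i a c) < 0`, whose value at `t = 0` is an eigenfunction of `L₃` with eigenvalue `i a c`.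
The Fourier frequencies of the profiles lie in `r + sℤ` exactly when shifting `x₃` by the
period `2π/s` of the stationary flow multiplies them by `e^{2π i r/s}`. -/
def HasUnstableSolution (ν α : ℝ) (U : E3 → ℝ) (s : ℕ) (a b r : ℤ) : Prop :=
  ∃ (c : ℂ) (W : Fin 3 → ℝ → ℂ) (Q : ℝ → ℂ),
    (Complex.I * a * c).re < 0 ∧
    (∀ j z, W j (z + 2 * Real.pi / s) = Complex.exp (2 * Real.pi * Complex.I * r / s) * W j z) ∧
    (∀ z, Q (z + 2 * Real.pi / s) = Complex.exp (2 * Real.pi * Complex.I * r / s) * Q z) ∧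
    IsLinearizedSolution ν α U (fun t j => mode a b c (W j) t) (fun t => mode a b c Q t) ∧
    IsEigenfunction ν α U (Complex.I * a * c) (fun j => mode a b c (W j) 0) (mode a b c Q 0)

/-- The region `A(δ)` (for the parameter `s`) of the `(t', r)`-plane. -/
def regionA (δ s : ℝ) : Set (ℝ × ℝ) :=
  {p | p.1 ^ 2 + p.2 ^ 2 < s ^ 2 / 3 ∧ s ^ 2 < p.1 ^ 2 + (-s + p.2) ^ 2 ∧
    s ^ 2 < p.1 ^ 2 + (s + p.2) ^ 2 ∧ δ * s ≤ p.1 ∧ -(s / 6) < p.2 ∧ p.2 < s / 6}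

/-- The rectangle `D = {c₃ s ≤ t' ≤ c₄ s, |r| ≤ c₂ s}` of the `(t', r)`-plane. -/
def rectD (c₂ c₃ c₄ s : ℝ) : Set (ℝ × ℝ) :=
  {p | c₃ * s ≤ p.1 ∧ p.1 ≤ c₄ * s ∧ |p.2| ≤ c₂ * s}

/-- The integer triples `(a, b, r)` with `c₃ s ≤ √(a² + b²) ≤ c₄ s`, `|r| ≤ c₂ s`, `|b| ≤ a`. -/
def triples (c₂ c₃ c₄ : ℝ) (s : ℕ) : Set (ℤ × ℤ × ℤ) :=
  {p | c₃ * s ≤ √((p.1 : ℝ) ^ 2 + (p.2.1 : ℝ) ^ 2) ∧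
    √((p.1 : ℝ) ^ 2 + (p.2.1 : ℝ) ^ 2) ≤ c₄ * s ∧
    |(p.2.2 : ℝ)| ≤ c₂ * s ∧ |p.2.1| ≤ p.1}

/-- The amplitude `λ = √2 c₁ s (1 + α² s²)²`. -/
def amplitude (c₁ α : ℝ) (s : ℕ) : ℝ :=
  √2 * c₁ * s * (1 + α ^ 2 * (s : ℝ) ^ 2) ^ 2

end ModifiedLerayAlpha

end

/-!
The linearized problem is solved by separation of variables. For wave numbers `a, b`, with
`mₙ = r + s n` and `Kₙ = a² + b² + mₙ²`, a profile with frequencies in `r + sℤ` is a Fourier series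
`∑ eₙ e^{i mₙ x₃}`. On the coefficients `eₙ` of the filtered field, multiplication by `sin (s x₃)`
couples neighbouring indices, while the Laplacian and the filter are diagonal. Taking the
divergence of the momentum equation expresses the pressure through the vertical component, and with
`dₙ = (Kₙ - s²) e₃,ₙ` and growth rate `σ = -i a c` the vertical equation becomes the three-term
recurrence `cₙ(σ) dₙ + dₙ₋₁ - dₙ₊₁ = 0`, where
`cₙ(σ) = Kₙ (1 + α² Kₙ) (σ + ν Kₙ) / (β (Kₙ - s²))` and `β` is proportional to the amplitude.

In the region `A(δ)` the coefficient `c₀` is negative and all others are positive. A bounded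
solution then exists for every `σ ≥ 0` at which `-c₀(σ)` equals the sum of the continued fractions
`[c₁(σ), c₂(σ), …]` and `[c₋₁(σ), c₋₂(σ), …]`. The left side is affine and increasing in `σ` and
the right side is bounded, so a root `σ > 0` exists as soon as the left side is smaller at `σ = 0`;
truncated continued fractions are treated by the intermediate value theorem, and a limit along an
ultrafilter removes the truncation (`exists_growth_rate`). The inequality at `σ = 0` only needs the
two coefficients next to `0` on the side of the sign of `r`, where `Kₙ - s² ≥ δ² s²`. With `c₁, c₂`
denoting these, it follows from `|c₀| c₁ + |c₀| / c₂ < 1`, where the product is small for large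
amplitude and the quotient does not depend on it (`dispersion_estimate`).

Given the vertical component, the second component solves a tridiagonal system with positive
diagonal and antisymmetric off-diagonal part, which is coercive (`exists_bounded_solution`), and the
first one is determined by the divergence-free condition. Bounded solutions of these recurrences
decay faster than any power because the diagonal grows (`rapidDecay_of_bounded`), so all profiles
are smooth, and `hasUnstableSolution_of_isCoeffSolution` translates the coefficients back into
functions on the torus.

The triples are counted as a product: the pairs `(a, b)` are the lattice points of a dilated sector
of an annulus, whose number is asymptotic to the area, and the `r` are the integers of an interval
(`tendsto_ncard_triples`).
-/

namespace ModifiedLerayAlpha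

/-! ### Three-term recurrences on the integers -/

/-- The finite continued fraction `1 / (c n + 1 / (c (n + 1) + ⋯))` with `N` levels. -/
noncomputable def contFrac (c : ℕ → ℝ) : ℕ → ℕ → ℝ
  | 0, _ => 0
  | N + 1, n => 1 / (c n + contFrac c N (n + 1))

lemma contFrac_nonneg {c : ℕ → ℝ} (hc : ∀ n, 0 < c n) (N n : ℕ) : 0 ≤ contFrac c N n := by
  induction N generalizing n with
  | zero => simp [contFrac]
  | succ N ih => have := ih (n + 1); have := hc n; simp only [contFrac]; positivity

lemma contFrac_le {c : ℕ → ℝ} (hc : ∀ n, 0 < c n) (N n : ℕ) : contFrac c N n ≤ 1 / c n := by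
  cases N with
  | zero => have := hc n; simp only [contFrac]; positivity
  | succ N =>
    exact one_div_le_one_div_of_le (hc n) (le_add_of_nonneg_right (contFrac_nonneg hc N _))

lemma le_contFrac {c : ℕ → ℝ} (hc : ∀ n, 0 < c n) (N n : ℕ) :
    1 / (c n + 1 / c (n + 1)) ≤ contFrac c (N + 1) n := by
  have h1 := hc n
  have h2 := contFrac_nonneg hc N (n + 1)
  exact one_div_le_one_div_of_le (by positivity) (by gcongr; exact contFrac_le hc N (n + 1))

lemma continuousOn_contFrac {c : ℕ → ℝ → ℝ} {S : Set ℝ} (hcont : ∀ n, ContinuousOn (c n) S)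
    (hc : ∀ n, ∀ σ ∈ S, 0 < c n σ) (N n : ℕ) :
    ContinuousOn (fun σ => contFrac (fun k => c k σ) N n) S := by
  induction N generalizing n with
  | zero => simpa [contFrac] using continuousOn_const
  | succ N ih =>
    simp only [contFrac]
    refine continuousOn_const.div ((hcont n).add (ih (n + 1))) fun σ hσ => ?_
    have := hc n σ hσ
    have := contFrac_nonneg (fun k => hc k σ hσ) N (n + 1)
    positivity

lemma exists_tendsto_of_mem_Icc (U : Ultrafilter ℕ) {u : ℕ → ℝ} {a b : ℝ}
    (hu : ∀ N, u N ∈ Set.Icc a b) : ∃ x ∈ Set.Icc a b, Tendsto u U (𝓝 x) := by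
  obtain ⟨x, hx, hle⟩ := (isCompact_Icc (a := a) (b := b)).ultrafilter_le_nhds (U.map u) (by
    rw [le_principal_iff]
    exact Filter.mem_map.2 (Filter.univ_mem' hu))
  exact ⟨x, hx, hle⟩

/-- Along an ultrafilter the truncated continued fractions converge at all levels, and the limits
satisfy the recurrence of the infinite continued fraction. -/
lemma exists_contFrac_limit (U : Ultrafilter ℕ) (hU : (U : Filter ℕ) ≤ atTop)
    {c : ℕ → ℝ → ℝ} (hcont : ∀ n, Continuous (c n)) (hc0 : ∀ n, 0 < c n 0)
    (hmono : ∀ n σ, 0 ≤ σ → c n 0 ≤ c n σ) {τ : ℕ → ℝ} {σ : ℝ} (hτ0 : ∀ N, 0 ≤ τ N)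
    (hτ : Tendsto τ U (𝓝 σ)) :
    ∃ p : ℕ → ℝ, (∀ n, 0 ≤ p n) ∧ (∀ n, p n * (c n σ + p (n + 1)) = 1) ∧
      Tendsto (fun N => contFrac (fun n => c n (τ N)) N 0) U (𝓝 (p 0)) := by
  have hpos : ∀ N n, 0 < c n (τ N) := fun N n => (hc0 n).trans_le (hmono n _ (hτ0 N))
  have hmem : ∀ n N, contFrac (fun k => c k (τ N)) (N - n) n ∈ Set.Icc 0 (1 / c n 0) :=
    fun n N => ⟨contFrac_nonneg (hpos N) _ _, (contFrac_le (hpos N) _ _).trans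
      (one_div_le_one_div_of_le (hc0 n) (hmono n _ (hτ0 N)))⟩
  choose p hp hlim using fun n => exists_tendsto_of_mem_Icc U (hmem n)
  refine ⟨p, fun n => (hp n).1, fun n => ?_, by simpa using hlim 0⟩
  have h1 : Tendsto (fun N => contFrac (fun k => c k (τ N)) (N - n) n *
      (c n (τ N) + contFrac (fun k => c k (τ N)) (N - (n + 1)) (n + 1))) U
      (𝓝 (p n * (c n σ + p (n + 1)))) :=
    (hlim n).mul ((((hcont n).tendsto σ).comp hτ).add (hlim (n + 1)))
  refine tendsto_nhds_unique (h1.congr' ?_) tendsto_const_nhds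
  filter_upwards [hU (eventually_gt_atTop n)] with N hN
  obtain ⟨j, rfl⟩ := Nat.exists_eq_add_of_lt hN
  have e1 : n + j + 1 - n = j + 1 := by omega
  have e2 : n + j + 1 - (n + 1) = j := by omega
  rw [e1, e2, contFrac]
  have h3 := hpos (n + j + 1) n
  have h4 := contFrac_nonneg (hpos (n + j + 1)) j (n + 1)
  exact one_div_mul_cancel (by positivity)

/-- The products of the ratios `p n` of a continued fraction are bounded, although single ratios
may exceed `1`. -/
lemma prod_range_ratio_le {p : ℕ → ℝ} (hp : ∀ n, 0 ≤ p n) (h : ∀ n, p n * p (n + 1) ≤ 1) (n : ℕ) :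
    ∏ i ∈ Finset.range n, p i ≤ 1 + p 0 := by
  have hp0 := hp 0
  induction n using Nat.twoStepInduction with
  | zero => simpa using hp0
  | one => simp
  | more n ih _ =>
    rw [Finset.prod_range_succ, Finset.prod_range_succ, mul_assoc]
    have : 0 ≤ ∏ i ∈ Finset.range n, p i := Finset.prod_nonneg fun i _ => hp i
    calc _ ≤ (∏ i ∈ Finset.range n, p i) * 1 := by gcongr; exact h n
      _ ≤ _ := by simpa using ih

/-- If two positive sequences of ratios solve the continued fraction recurrences to the right and
to the left of `0` and match at `0`, they yield a bounded solution on `ℤ`. -/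
lemma exists_bounded_of_ratios {c : ℤ → ℝ} {p q : ℕ → ℝ} (hp : ∀ n, 0 ≤ p n) (hq : ∀ n, 0 ≤ q n)
    (hc : ∀ n, n ≠ 0 → 0 < c n)
    (hpr : ∀ n : ℕ, p n * (c (n + 1) + p (n + 1)) = 1)
    (hqr : ∀ n : ℕ, q n * (c (-(n + 1)) + q (n + 1)) = 1) (h0 : -c 0 = p 0 + q 0) :
    ∃ d : ℤ → ℝ, d 0 = 1 ∧ (∃ C, ∀ n, |d n| ≤ C) ∧
      ∀ n, c n * d n + d (n - 1) - d (n + 1) = 0 := by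
  set P : ℕ → ℝ := fun n => ∏ i ∈ Finset.range n, (-(p i)) with hP
  set Q : ℕ → ℝ := fun n => ∏ i ∈ Finset.range n, q i with hQ
  set d : ℤ → ℝ := fun n => if 0 ≤ n then P n.toNat else Q (-n).toNat with hd
  have hdP : ∀ n : ℕ, d n = P n := fun n => by simp [hd]
  have hdQ : ∀ n : ℕ, d (-(n : ℤ)) = Q n := fun n => by
    rcases Nat.eq_zero_or_pos n with rfl | h
    · simp [hd, hP, hQ]
    · simp [hd, h.ne']
  have hPs : ∀ n, P (n + 1) = P n * -(p n) := fun n => Finset.prod_range_succ _ _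
  have hQs : ∀ n, Q (n + 1) = Q n * q n := fun n => Finset.prod_range_succ _ _
  have hpp : ∀ n, p n * p (n + 1) ≤ 1 := fun n => by
    have := hpr n
    have := mul_nonneg (hp n) (hc (n + 1) (by omega)).le
    linarith
  have hqq : ∀ n, q n * q (n + 1) ≤ 1 := fun n => by
    have := hqr n
    have := mul_nonneg (hq n) (hc (-(n + 1)) (by omega)).le
    linarith
  refine ⟨d, by simp [hd, hP], ⟨(1 + p 0) + (1 + q 0), fun n => ?_⟩, fun n => ?_⟩
  · have hp0 := hp 0
    have hq0 := hq 0
    obtain ⟨k, rfl | rfl⟩ := n.eq_nat_or_neg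
    · rw [hdP, hP, Finset.abs_prod]
      have := prod_range_ratio_le hp hpp k
      simp only [abs_neg, abs_of_nonneg (hp _)]
      linarith
    · rw [hdQ, hQ, Finset.abs_prod]
      have := prod_range_ratio_le hq hqq k
      simp only [abs_of_nonneg (hq _)]
      linarith
  · obtain ⟨k, rfl | rfl⟩ := n.eq_nat_or_neg
    · rcases k with _ | k
      · have e1 : d (((0 : ℕ) : ℤ) - 1) = Q 1 := by rw [← hdQ]; norm_num
        have e2 : d (((0 : ℕ) : ℤ) + 1) = P 1 := by rw [← hdP]; norm_num
        rw [e1, e2, hdP, hPs, hQs]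
        simp only [hP, hQ, Finset.range_zero, Finset.prod_empty, Nat.cast_zero]
        linarith
      · have e1 : d (((k + 1 : ℕ) : ℤ) - 1) = P k := by rw [← hdP]; congr 1; push_cast; ring
        have e2 : d (((k + 1 : ℕ) : ℤ) + 1) = P (k + 2) := by
          rw [← hdP]; congr 1
        rw [e1, e2, hdP, hPs (k + 1), hPs k]
        have := hpr k
        push_cast
        linear_combination -P k * this
    · rcases k with _ | k
      · have e1 : d (-((0 : ℕ) : ℤ) - 1) = Q 1 := by rw [← hdQ]; simp
        have e2 : d (-((0 : ℕ) : ℤ) + 1) = P 1 := by rw [← hdP]; simp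
        rw [e1, e2, hdQ, hPs, hQs]
        simp only [hP, hQ, Finset.range_zero, Finset.prod_empty, Nat.cast_zero, neg_zero]
        linarith
      · have e1 : d (-((k + 1 : ℕ) : ℤ) + 1) = Q k := by rw [← hdQ]; congr 1; push_cast; ring
        have e2 : d (-((k + 1 : ℕ) : ℤ) - 1) = Q (k + 2) := by
          rw [← hdQ]; congr 1
        rw [e1, e2, hdQ, hQs (k + 1), hQs k]
        have := hqr k
        push_cast
        linear_combination Q k * this

/-- **Existence of a positive growth rate.** If the central coefficient `c₀(σ) = h₀ (σ + κ₀)` is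
negative, the others are positive, and the dispersion relation
`-c₀(σ) = [c₁(σ), c₂(σ), …] + [c₋₁(σ), c₋₂(σ), …]` has its left side below a lower bound of its
right side at `σ = 0`, then the recurrence has a bounded solution for some `σ > 0`. The relation is
solved for the truncated continued fractions by the intermediate value theorem, and the truncation
is removed by compactness. -/
lemma exists_growth_rate {h κ : ℤ → ℝ} (hκ : ∀ n, 0 < κ n) (h0 : h 0 < 0)
    (hpos : ∀ n, n ≠ 0 → 0 < h n)
    (hlt : -(h 0 * κ 0) < 1 / (h 1 * κ 1 + 1 / (h 2 * κ 2)) +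
      1 / (h (-1) * κ (-1) + 1 / (h (-2) * κ (-2)))) :
    ∃ σ > 0, ∃ d : ℤ → ℝ, d 0 = 1 ∧ (∃ C, ∀ n, |d n| ≤ C) ∧
      ∀ n, h n * (σ + κ n) * d n + d (n - 1) - d (n + 1) = 0 := by
  set cp : ℕ → ℝ → ℝ := fun n σ => h (n + 1) * (σ + κ (n + 1)) with hcp
  set cm : ℕ → ℝ → ℝ := fun n σ => h (-(n + 1)) * (σ + κ (-(n + 1))) with hcm
  have hcpc : ∀ n, Continuous (cp n) := fun n => by fun_prop
  have hcmc : ∀ n, Continuous (cm n) := fun n => by fun_prop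
  have hcpp : ∀ n σ, 0 ≤ σ → 0 < cp n σ := fun n σ hσ =>
    mul_pos (hpos _ (by omega)) (by have := hκ (n + 1); positivity)
  have hcmp : ∀ n σ, 0 ≤ σ → 0 < cm n σ := fun n σ hσ =>
    mul_pos (hpos _ (by omega)) (by have := hκ (-(n + 1)); positivity)
  have hcpm : ∀ n σ, 0 ≤ σ → cp n 0 ≤ cp n σ := fun n σ hσ =>
    mul_le_mul_of_nonneg_left (by linarith) (hpos _ (by omega)).le
  have hcmm : ∀ n σ, 0 ≤ σ → cm n 0 ≤ cm n σ := fun n σ hσ =>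
    mul_le_mul_of_nonneg_left (by linarith) (hpos _ (by omega)).le
  have hlt' : -(h 0 * κ 0) < 1 / (cp 0 0 + 1 / cp 1 0) + 1 / (cm 0 0 + 1 / cm 1 0) := by
    simp only [hcp, hcm]
    norm_num at hlt ⊢
    exact hlt
  clear_value cp cm
  have hpos' : ∀ n, 0 < cp n 0 := fun n => hcpp n 0 le_rfl
  have hmos' : ∀ n, 0 < cm n 0 := fun n => hcmp n 0 le_rfl
  set B : ℝ := 1 / cp 0 0 + 1 / cm 0 0 with hB
  have hB0 : 0 ≤ B := by have := hpos' 0; have := hmos' 0; positivity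
  set M : ℝ := B / -h 0 with hM
  have hM0 : 0 ≤ M := div_nonneg hB0 (by linarith)
  have hroot : ∀ N : ℕ, ∃ τ ∈ Set.Icc 0 M, -(h 0 * (τ + κ 0)) =
      contFrac (fun n => cp n τ) (N + 2) 0 + contFrac (fun n => cm n τ) (N + 2) 0 := by
    intro N
    have hcont : ContinuousOn (fun τ => -(h 0 * (τ + κ 0)) -
        (contFrac (fun n => cp n τ) (N + 2) 0 + contFrac (fun n => cm n τ) (N + 2) 0))
        (Set.Icc 0 M) := by
      refine ContinuousOn.sub (by fun_prop) (ContinuousOn.add ?_ ?_)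
      · exact continuousOn_contFrac (fun n => (hcpc n).continuousOn)
          (fun n τ hτ => hcpp n τ hτ.1) _ _
      · exact continuousOn_contFrac (fun n => (hcmc n).continuousOn)
          (fun n τ hτ => hcmp n τ hτ.1) _ _
    obtain ⟨τ, hτ, hval⟩ := intermediate_value_Icc hM0 hcont (show (0 : ℝ) ∈ Set.Icc _ _ by
      constructor
      · have h1 := le_contFrac hpos' (N + 1) 0
        have h2 := le_contFrac hmos' (N + 1) 0
        simp only [zero_add] at h1 h2 ⊢
        linarith
      · have h1 := (contFrac_le (fun n => hcpp n M hM0) (N + 2) 0).trans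
          (one_div_le_one_div_of_le (hpos' 0) (hcpm 0 M hM0))
        have h2 := (contFrac_le (fun n => hcmp n M hM0) (N + 2) 0).trans
          (one_div_le_one_div_of_le (hmos' 0) (hcmm 0 M hM0))
        have h3 : -h 0 * M = B := mul_div_cancel₀ _ (by linarith)
        have h4 : 0 < -h 0 * κ 0 := mul_pos (by linarith) (hκ 0)
        linarith)
    exact ⟨τ, hτ, by simpa [sub_eq_zero] using hval⟩
  choose τ hτ hτeq using hroot
  -- the truncation with `N` levels is solved by `τ (N - 2)`
  set U : Ultrafilter ℕ := Filter.hyperfilter ℕ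
  have hU : (U : Filter ℕ) ≤ atTop := Nat.hyperfilter_le_atTop
  obtain ⟨σ, hσ, hlim⟩ := exists_tendsto_of_mem_Icc U (fun N => hτ (N - 2))
  obtain ⟨p, hp, hpr, hplim⟩ :=
    exists_contFrac_limit U hU hcpc hpos' hcpm (fun N => (hτ (N - 2)).1) hlim
  obtain ⟨q, hq, hqr, hqlim⟩ :=
    exists_contFrac_limit U hU hcmc hmos' hcmm (fun N => (hτ (N - 2)).1) hlim
  have hdisp : -(h 0 * (σ + κ 0)) = p 0 + q 0 := by
    refine tendsto_nhds_unique (f := fun N => -(h 0 * (τ (N - 2) + κ 0))) (l := (U : Filter ℕ))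
      ((tendsto_const_nhds.mul (hlim.add tendsto_const_nhds)).neg) ((hplim.add hqlim).congr' ?_)
    filter_upwards [hU (eventually_ge_atTop 2)] with N hN
    obtain ⟨j, rfl⟩ := Nat.exists_eq_add_of_le' hN
    exact (hτeq j).symm
  have hσpos : 0 < σ := by
    refine lt_of_le_of_ne hσ.1 fun h => ?_
    subst h
    have key : ∀ {c : ℕ → ℝ} {p : ℕ → ℝ}, (∀ n, 0 < c n) → (∀ n, 0 ≤ p n) →
        (∀ n, p n * (c n + p (n + 1)) = 1) → 1 / (c 0 + 1 / c 1) ≤ p 0 := by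
      intro c p hc hp hr
      have e : ∀ n, p n = 1 / (c n + p (n + 1)) := fun n => by
        rw [eq_div_iff (by have := hc n; have := hp (n + 1); positivity)]; exact hr n
      have h1 : p 1 ≤ 1 / c 1 := by
        rw [e 1]; exact one_div_le_one_div_of_le (hc 1) (le_add_of_nonneg_right (hp 2))
      rw [e 0]
      exact one_div_le_one_div_of_le (by have := hc 0; have := hp 1; positivity) (by simpa using h1)
    have h1 := key hpos' hp hpr
    have h2 := key hmos' hq hqr
    rw [zero_add] at hdisp
    linarith
  refine ⟨σ, hσpos, exists_bounded_of_ratios (c := fun n => h n * (σ + κ n)) hp hq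
    (fun n hn => mul_pos (hpos n hn) (by have := hκ n; positivity)) ?_ ?_ hdisp⟩
  · intro n; simpa [hcp] using hpr n
  · intro n; simpa [hcm] using hqr n

/-- The antisymmetric off-diagonal part of a tridiagonal operator does not contribute to the
energy. -/
lemma sum_antisymm_eq_zero {X : ℤ → ℝ} (s : Finset ℤ) (hX : ∀ n ∉ s, X n = 0) :
    ∑ n ∈ s, X n * (X (n - 1) - X (n + 1)) = 0 := by
  have h1 : ∑ n ∈ s, X n * X (n - 1) = ∑' n, X n * X (n - 1) :=
    (tsum_eq_sum fun n hn => by simp [hX n hn]).symm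
  have h2 : ∑ n ∈ s, X n * X (n + 1) = ∑' n, X n * X (n + 1) :=
    (tsum_eq_sum fun n hn => by simp [hX n hn]).symm
  have h3 : ∑' n, X n * X (n - 1) = ∑' n, X n * X (n + 1) := by
    rw [← (Equiv.addRight (1 : ℤ)).tsum_eq]
    simp [mul_comm]
  simp only [mul_sub, Finset.sum_sub_distrib, h1, h2, h3, sub_self]

lemma exists_truncated_solution {g : ℤ → ℝ} (hg : ∀ n, 0 < g n) (f : ℤ → ℝ) (β : ℝ)
    (s : Finset ℤ) :
    ∃ e : ℤ → ℝ, (∀ n ∉ s, e n = 0) ∧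
      ∀ n ∈ s, g n * e n + β * (e (n - 1) - e (n + 1)) = f n := by
  set ι := {n // n ∈ s}
  set Z : (ι → ℝ) →ₗ[ℝ] (ℤ → ℝ) := Function.ExtendByZero.linearMap ℝ (Subtype.val : ι → ℤ) with hZ
  have hZs : ∀ (x : ι → ℝ) (i : ι), Z x i = x i := fun x i =>
    Subtype.val_injective.extend_apply _ _ _
  have hZn : ∀ (x : ι → ℝ), ∀ n ∉ s, Z x n = 0 := fun x n hn =>
    Function.extend_apply' _ _ _ (by rintro ⟨i, rfl⟩; exact hn i.2)
  set T : (ι → ℝ) →ₗ[ℝ] (ι → ℝ) :=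
    { toFun := fun x i => g i * Z x i + β * (Z x (i - 1) - Z x (i + 1))
      map_add' := fun x y => by ext i; simp only [map_add, Pi.add_apply]; ring
      map_smul' := fun c x => by
        ext i; simp only [map_smul, Pi.smul_apply, smul_eq_mul, RingHom.id_apply]; ring } with hT
  have hinj : Function.Injective T := by
    rw [injective_iff_map_eq_zero]
    intro x hx
    have h1 : ∀ n ∈ s, g n * Z x n + β * (Z x (n - 1) - Z x (n + 1)) = 0 := fun n hn =>
      congrFun hx ⟨n, hn⟩
    have h2 : ∑ n ∈ s, g n * Z x n ^ 2 = 0 := by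
      have : ∑ n ∈ s, (g n * Z x n ^ 2 + β * (Z x n * (Z x (n - 1) - Z x (n + 1)))) = 0 :=
        Finset.sum_eq_zero fun n hn => by linear_combination Z x n * h1 n hn
      rwa [Finset.sum_add_distrib, ← Finset.mul_sum, sum_antisymm_eq_zero s (hZn x), mul_zero,
        add_zero] at this
    have h3 := (Finset.sum_eq_zero_iff_of_nonneg fun n _ =>
      mul_nonneg (hg n).le (sq_nonneg (Z x n))).1 h2
    ext i
    have := h3 i i.2
    rw [hZs] at this
    simpa [(hg i).ne'] using this
  obtain ⟨x, hx⟩ := (LinearMap.injective_iff_surjective.1 hinj) (fun i => f i)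
  exact ⟨Z x, hZn x, fun n hn => congrFun hx ⟨n, hn⟩⟩

/-- A tridiagonal system on `ℤ` with diagonal bounded below by a positive constant and antisymmetric
off-diagonal part has a bounded solution for every summable right-hand side: the truncated systems
are coercive with a uniform bound, and the truncation is removed by compactness. -/
lemma exists_bounded_solution {g f : ℤ → ℝ} {g₀ : ℝ} (β : ℝ) (hg₀ : 0 < g₀) (hg : ∀ n, g₀ ≤ g n)
    (hf : Summable f) :
    ∃ e : ℤ → ℝ, (∃ C, ∀ n, |e n| ≤ C) ∧
      ∀ n, g n * e n + β * (e (n - 1) - e (n + 1)) = f n := by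
  have hgpos : ∀ n, 0 < g n := fun n => hg₀.trans_le (hg n)
  choose e hzero heq using fun N : ℕ => exists_truncated_solution hgpos f β (Finset.Icc (-N : ℤ) N)
  set F : ℝ := ∑' n, |f n|
  have hF0 : 0 ≤ F := tsum_nonneg fun n => abs_nonneg _
  have hbound : ∀ n N, |e N n| ≤ F / g₀ := by
    intro n N
    set s := Finset.Icc (-N : ℤ) N with hs
    have hne : s.Nonempty := ⟨0, by simp [hs]⟩
    obtain ⟨k, hk, hmax⟩ := s.exists_max_image (fun n => |e N n|) hne
    have hen : |e N n| ≤ |e N k| := by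
      by_cases hn : n ∈ s
      · exact hmax n hn
      · rw [hzero N n hn]; simp
    have h1 : ∑ n ∈ s, g n * e N n ^ 2 = ∑ n ∈ s, f n * e N n := by
      have : ∑ n ∈ s, (g n * e N n ^ 2 + β * (e N n * (e N (n - 1) - e N (n + 1)))) =
          ∑ n ∈ s, f n * e N n :=
        Finset.sum_congr rfl fun n hn => by linear_combination e N n * heq N n hn
      rwa [Finset.sum_add_distrib, ← Finset.mul_sum, sum_antisymm_eq_zero s (hzero N), mul_zero,
        add_zero] at this
    have h2 : g₀ * e N k ^ 2 ≤ ∑ n ∈ s, g n * e N n ^ 2 :=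
      (mul_le_mul_of_nonneg_right (hg k) (sq_nonneg _)).trans
        (Finset.single_le_sum (f := fun n => g n * e N n ^ 2)
          (fun n _ => mul_nonneg (hgpos n).le (sq_nonneg _)) hk)
    have h3 : ∑ n ∈ s, f n * e N n ≤ F * |e N k| := by
      calc _ ≤ ∑ n ∈ s, |f n| * |e N k| := Finset.sum_le_sum fun n hn =>
            (le_abs_self _).trans (by
              rw [abs_mul]; exact mul_le_mul_of_nonneg_left (hmax n hn) (abs_nonneg _))
        _ = (∑ n ∈ s, |f n|) * |e N k| := (Finset.sum_mul ..).symm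
        _ ≤ _ := by gcongr; exact hf.abs.sum_le_tsum s fun _ _ => abs_nonneg _
    have h4 : g₀ * |e N k| * |e N k| ≤ F * |e N k| := by
      have := sq_abs (e N k)
      nlinarith
    rw [le_div_iff₀ hg₀]
    rcases (abs_nonneg (e N k)).eq_or_lt with h0 | h0
    · have : |e N n| = 0 := le_antisymm (h0 ▸ hen) (abs_nonneg _)
      simpa [this] using hF0
    · have := le_of_mul_le_mul_right h4 h0
      nlinarith
  set U : Ultrafilter ℕ := Filter.hyperfilter ℕ
  have hU : (U : Filter ℕ) ≤ atTop := Nat.hyperfilter_le_atTop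
  choose x hx hlim using fun n =>
    exists_tendsto_of_mem_Icc U (u := fun N => e N n) fun N => abs_le.1 (hbound n N)
  refine ⟨x, ⟨F / g₀, fun n => abs_le.2 (hx n)⟩, fun n => ?_⟩
  have h1 : Tendsto (fun N => g n * e N n + β * (e N (n - 1) - e N (n + 1))) U
      (𝓝 (g n * x n + β * (x (n - 1) - x (n + 1)))) :=
    (tendsto_const_nhds.mul (hlim n)).add
      (tendsto_const_nhds.mul ((hlim (n - 1)).sub (hlim (n + 1))))
  refine tendsto_nhds_unique (h1.congr' ?_) tendsto_const_nhds
  filter_upwards [hU (eventually_ge_atTop n.natAbs)] with N hN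
  exact heq N n (by rw [Finset.mem_Icc]; omega)

/-! ### Rapidly decaying sequences -/

/-- A sequence indexed by `ℤ` which decays faster than every power of `n`. -/
def RapidDecay {F : Type*} [NormedAddCommGroup F] (w : ℤ → F) : Prop :=
  ∀ k : ℕ, ∃ C : ℝ, ∀ n : ℤ, (1 + |(n : ℝ)|) ^ k * ‖w n‖ ≤ C

/-- A sequence indexed by `ℤ` which grows at most like a power of `n`. -/
def PolyGrowth {F : Type*} [NormedAddCommGroup F] (m : ℤ → F) : Prop :=
  ∃ (C : ℝ) (j : ℕ), ∀ n : ℤ, ‖m n‖ ≤ C * (1 + |(n : ℝ)|) ^ j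

namespace RapidDecay

variable {F : Type*} [NormedAddCommGroup F] {w v : ℤ → F}

lemma add (hw : RapidDecay w) (hv : RapidDecay v) : RapidDecay (fun n => w n + v n) := by
  intro k
  obtain ⟨C, hC⟩ := hw k
  obtain ⟨D, hD⟩ := hv k
  refine ⟨C + D, fun n => ?_⟩
  calc _ ≤ (1 + |(n : ℝ)|) ^ k * (‖w n‖ + ‖v n‖) := by gcongr; exact norm_add_le _ _
    _ ≤ _ := by rw [mul_add]; exact add_le_add (hC n) (hD n)

lemma of_norm_eq {G : Type*} [NormedAddCommGroup G] {u : ℤ → G} (hw : RapidDecay w)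
    (h : ∀ n, ‖u n‖ = ‖w n‖) : RapidDecay u := by
  intro k
  simpa only [h] using hw k

lemma poly_mul {𝕜 : Type*} [RCLike 𝕜] {w m : ℤ → 𝕜} (hw : RapidDecay w) (hm : PolyGrowth m) :
    RapidDecay (fun n => m n * w n) := by
  obtain ⟨C, j, hC⟩ := hm
  intro k
  obtain ⟨D, hD⟩ := hw (j + k)
  have hC0 : 0 ≤ C := by simpa using (norm_nonneg _).trans (hC 0)
  refine ⟨C * D, fun n => ?_⟩
  rw [norm_mul]
  calc _ ≤ (1 + |(n : ℝ)|) ^ k * (C * (1 + |(n : ℝ)|) ^ j * ‖w n‖) := by gcongr; exact hC n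
    _ = C * ((1 + |(n : ℝ)|) ^ (j + k) * ‖w n‖) := by ring
    _ ≤ C * D := by gcongr; exact hD n

/-- Stability under shifts, from `1 + |n| ≤ (1 + |i|) (1 + |n + i|)`. -/
lemma shift (hw : RapidDecay w) (i : ℤ) : RapidDecay (fun n => w (n + i)) := by
  intro k
  obtain ⟨C, hC⟩ := hw k
  refine ⟨(1 + |(i : ℝ)|) ^ k * C, fun n => ?_⟩
  have h1 : 1 + |(n : ℝ)| ≤ (1 + |(i : ℝ)|) * (1 + |((n + i : ℤ) : ℝ)|) := by
    have h2 := abs_sub (((n + i : ℤ) : ℝ)) i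
    have h3 := abs_nonneg (i : ℝ)
    have h4 := abs_nonneg (((n + i : ℤ) : ℝ))
    push_cast at *
    rw [add_sub_cancel_right] at h2
    nlinarith
  calc _ ≤ ((1 + |(i : ℝ)|) * (1 + |((n + i : ℤ) : ℝ)|)) ^ k * ‖w (n + i)‖ := by gcongr
    _ = (1 + |(i : ℝ)|) ^ k * ((1 + |((n + i : ℤ) : ℝ)|) ^ k * ‖w (n + i)‖) := by rw [mul_pow]; ring
    _ ≤ _ := by gcongr; exact hC _

lemma summable_norm (hw : RapidDecay w) : Summable fun n => ‖w n‖ := by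
  obtain ⟨C, hC⟩ := hw 2
  have hs : Summable fun n : ℤ => C * ((1 + |(n : ℝ)|) ^ 2)⁻¹ := by
    refine Summable.mul_left C (Summable.of_norm_bounded_eventually
      (g := fun n : ℤ => 1 / |(n : ℝ)| ^ (2 : ℝ)) ?_ ?_)
    · exact (Real.summable_one_div_int_add_rpow 0 2).2 (by norm_num) |>.congr (by simp)
    · filter_upwards [eventually_cofinite_ne (0 : ℤ)] with n hn
      have : 0 < |(n : ℝ)| := by positivity
      rw [Real.norm_of_nonneg (by positivity), ← one_div, Real.rpow_two]
      exact one_div_le_one_div_of_le (by positivity) (by gcongr; linarith)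
  refine Summable.of_nonneg_of_le (fun n => norm_nonneg _) (fun n => ?_) hs
  rw [← div_eq_mul_inv, le_div_iff₀ (by positivity), mul_comm]
  exact hC n

end RapidDecay

section

variable {𝕜 : Type*} [RCLike 𝕜]

lemma PolyGrowth.mul {m m' : ℤ → 𝕜} (h : PolyGrowth m) (h' : PolyGrowth m') :
    PolyGrowth fun n => m n * m' n := by
  obtain ⟨C, j, hC⟩ := h
  obtain ⟨D, i, hD⟩ := h'
  refine ⟨C * D, j + i, fun n => ?_⟩
  rw [norm_mul]
  calc _ ≤ (C * (1 + |(n : ℝ)|) ^ j) * (D * (1 + |(n : ℝ)|) ^ i) :=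
        mul_le_mul (hC n) (hD n) (norm_nonneg _) ((norm_nonneg _).trans (hC n))
    _ = _ := by ring

lemma PolyGrowth.add {m m' : ℤ → 𝕜} (h : PolyGrowth m) (h' : PolyGrowth m') :
    PolyGrowth fun n => m n + m' n := by
  obtain ⟨C, j, hC⟩ := h
  obtain ⟨D, i, hD⟩ := h'
  have hC0 : 0 ≤ C := by simpa using (norm_nonneg _).trans (hC 0)
  have hD0 : 0 ≤ D := by simpa using (norm_nonneg _).trans (hD 0)
  refine ⟨C + D, max j i, fun n => (norm_add_le _ _).trans ?_⟩
  rw [add_mul]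
  have h1 : 1 ≤ 1 + |(n : ℝ)| := by simp
  exact add_le_add ((hC n).trans (by gcongr; exact le_max_left _ _))
    ((hD n).trans (by gcongr; exact le_max_right _ _))

lemma PolyGrowth.const (c : 𝕜) : PolyGrowth fun _ => c := ⟨‖c‖, 0, fun n => by simp⟩

lemma PolyGrowth.intCast : PolyGrowth fun n : ℤ => (n : 𝕜) :=
  ⟨1, 1, fun n => by
    simp only [← RCLike.ofReal_intCast (K := 𝕜), RCLike.norm_ofReal]; simp⟩

end

/-- **Elliptic regularity for recurrences.** If the diagonal grows at least linearly, a bounded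
solution of a three-term recurrence with rapidly decaying right-hand side decays rapidly. -/
lemma rapidDecay_of_bounded {e f : ℤ → ℝ} {κ β : ℝ} (hκ : 0 < κ) (hβ : 0 ≤ β)
    (hf : RapidDecay f) (he : ∃ C, ∀ n, |e n| ≤ C)
    (h : ∀ n : ℤ, κ * (1 + |(n : ℝ)|) * |e n| ≤ |f n| + β * (|e (n - 1)| + |e (n + 1)|)) :
    RapidDecay e := by
  intro k
  induction k with
  | zero => simpa using he
  | succ k ih =>
    obtain ⟨C, hC⟩ := ih
    obtain ⟨D, hD⟩ := hf k
    have hC0 : 0 ≤ C := by simpa using (abs_nonneg _).trans (by simpa using hC 0)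
    have hsh : ∀ n i : ℤ, |(i : ℝ)| = 1 → (1 + |(n : ℝ)|) ^ k * |e (n + i)| ≤ 2 ^ k * C := by
      intro n i hi
      have h1 : 1 + |(n : ℝ)| ≤ 2 * (1 + |((n + i : ℤ) : ℝ)|) := by
        have h2 := abs_sub (((n + i : ℤ) : ℝ)) i
        have h4 := abs_nonneg (((n + i : ℤ) : ℝ))
        push_cast at *
        rw [add_sub_cancel_right] at h2
        linarith
      calc _ ≤ (2 * (1 + |((n + i : ℤ) : ℝ)|)) ^ k * |e (n + i)| := by gcongr
        _ = 2 ^ k * ((1 + |((n + i : ℤ) : ℝ)|) ^ k * |e (n + i)|) := by rw [mul_pow]; ring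
        _ ≤ _ := by gcongr; exact hC _
    refine ⟨(D + β * (2 ^ k * C + 2 ^ k * C)) / κ, fun n => ?_⟩
    rw [le_div_iff₀ hκ, Real.norm_eq_abs]
    calc _ = (1 + |(n : ℝ)|) ^ k * (κ * (1 + |(n : ℝ)|) * |e n|) := by ring
      _ ≤ (1 + |(n : ℝ)|) ^ k * (|f n| + β * (|e (n - 1)| + |e (n + 1)|)) := by
        gcongr; exact h n
      _ = (1 + |(n : ℝ)|) ^ k * |f n| + β * ((1 + |(n : ℝ)|) ^ k * |e (n + (-1))| +
          (1 + |(n : ℝ)|) ^ k * |e (n + 1)|) := by rw [← sub_eq_add_neg]; ring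
      _ ≤ _ := by
        exact add_le_add (hD n) (mul_le_mul_of_nonneg_left
          (add_le_add (hsh n (-1) (by simp)) (hsh n 1 (by simp))) hβ)

/-! ### Fourier series with frequencies in a residue class -/

/-- The Fourier series `∑ₙ wₙ e^{i (r + s n) z}` with frequencies in `r + sℤ`. -/
noncomputable def fourierSum (r : ℤ) (s : ℕ) (w : ℤ → ℂ) (z : ℝ) : ℂ :=
  ∑' n : ℤ, w n * Complex.exp (Complex.I * (r + s * n) * z)

section

variable {r : ℤ} {s : ℕ} {w v : ℤ → ℂ}

lemma norm_exp_freq (r : ℤ) (s : ℕ) (n : ℤ) (z : ℝ) :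
    ‖Complex.exp (Complex.I * (r + s * n) * z)‖ = 1 := by
  have : Complex.I * (r + s * n) * z = (((r + s * n) * z : ℝ) : ℂ) * Complex.I := by
    push_cast; ring
  rw [this, Complex.norm_exp_ofReal_mul_I]

lemma summable_fourier (hw : RapidDecay w) (z : ℝ) :
    Summable fun n : ℤ => w n * Complex.exp (Complex.I * (r + s * n) * z) :=
  Summable.of_norm (by simpa only [norm_mul, norm_exp_freq, mul_one] using hw.summable_norm)

lemma hasSum_fourierSum (hw : RapidDecay w) (z : ℝ) :
    HasSum (fun n : ℤ => w n * Complex.exp (Complex.I * (r + s * n) * z)) (fourierSum r s w z) :=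
  (summable_fourier hw z).hasSum

lemma polyGrowth_freq (r : ℤ) (s : ℕ) : PolyGrowth fun n : ℤ => Complex.I * (r + s * n) :=
  (PolyGrowth.const _).mul ((PolyGrowth.const _).add ((PolyGrowth.const _).mul PolyGrowth.intCast))

lemma hasDerivAt_fourierSum (hw : RapidDecay w) (z : ℝ) :
    HasDerivAt (fourierSum r s w)
      (fourierSum r s (fun n => Complex.I * (r + s * n) * w n) z) z := by
  have hd := hw.poly_mul (polyGrowth_freq r s)
  have key := hasDerivAt_tsum (𝕜 := ℝ) (y₀ := 0)
    (g := fun (n : ℤ) (y : ℝ) => w n * Complex.exp (Complex.I * (r + s * n) * y))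
    (g' := fun (n : ℤ) (y : ℝ) => Complex.I * (r + s * n) * w n *
      Complex.exp (Complex.I * (r + s * n) * y))
    hd.summable_norm (fun n y => ?_) (fun n y => ?_) (summable_fourier hw 0) z
  · exact key
  · have h1 : HasDerivAt (fun y : ℝ => Complex.I * (r + s * n) * (y : ℂ))
        (Complex.I * (r + s * n)) y := by
      simpa using (Complex.ofRealCLM.hasDerivAt (x := y)).const_mul (Complex.I * (r + s * n))
    convert! h1.cexp.const_mul (w n) using 1
    ring
  · rw [norm_mul, norm_exp_freq, mul_one]

lemma contDiff_fourierSum (hw : RapidDecay w) :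
    ContDiff ℝ ((⊤ : ℕ∞) : WithTop ℕ∞) (fourierSum r s w) := by
  rw [contDiff_infty]
  intro k
  induction k generalizing w with
  | zero =>
    exact contDiff_zero.2 (continuous_iff_continuousAt.2 fun z =>
      (hasDerivAt_fourierSum hw z).continuousAt)
  | succ k ih =>
    push_cast
    refine contDiff_succ_iff_deriv.2 ⟨fun z => (hasDerivAt_fourierSum hw z).differentiableAt,
      fun h => by simp at h, ?_⟩
    rw [show deriv (fourierSum r s w) = _ from funext fun z => (hasDerivAt_fourierSum hw z).deriv]
    exact ih (hw.poly_mul (polyGrowth_freq r s))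

lemma fourierSum_add (hw : RapidDecay w) (hv : RapidDecay v) (z : ℝ) :
    fourierSum r s w z + fourierSum r s v z = fourierSum r s (fun n => w n + v n) z := by
  refine ((hasSum_fourierSum hw z).add (hasSum_fourierSum hv z)).unique ?_
  simpa only [add_mul] using hasSum_fourierSum (hw.add hv) z

lemma mul_fourierSum (c : ℂ) (z : ℝ) :
    c * fourierSum r s w z = fourierSum r s (fun n => c * w n) z := by
  simp only [fourierSum, mul_assoc, tsum_mul_left]

lemma exp_mul_fourierSum (k : ℤ) (z : ℝ) :
    Complex.exp (Complex.I * (s * k) * z) * fourierSum r s w z =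
      fourierSum r s (fun n => w (n - k)) z := by
  rw [fourierSum, fourierSum, ← tsum_mul_left,
    ← (Equiv.addRight k).tsum_eq fun n : ℤ => w (n - k) * Complex.exp (Complex.I * (r + s * n) * z)]
  refine tsum_congr fun n => ?_
  rw [Equiv.coe_addRight, add_sub_cancel_right, mul_left_comm, ← Complex.exp_add]
  congr 2
  push_cast
  ring

lemma sin_mul_fourierSum (hw : RapidDecay w) (z : ℝ) :
    ((Real.sin (s * z) : ℝ) : ℂ) * fourierSum r s w z =
      fourierSum r s (fun n => (w (n - 1) - w (n + 1)) / (2 * Complex.I)) z := by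
  have h1 := exp_mul_fourierSum (r := r) (s := s) (w := w) 1 z
  have h2 := exp_mul_fourierSum (r := r) (s := s) (w := w) (-1) z
  have hd : RapidDecay fun n => (1 / (2 * Complex.I)) * w (n + -1) :=
    (hw.shift (-1)).poly_mul (PolyGrowth.const _)
  have hd' : RapidDecay fun n => (-1 / (2 * Complex.I)) * w (n + 1) :=
    (hw.shift 1).poly_mul (PolyGrowth.const _)
  have e : (fun n => (w (n - 1) - w (n + 1)) / (2 * Complex.I)) =
      fun n => (1 / (2 * Complex.I)) * w (n + -1) + (-1 / (2 * Complex.I)) * w (n + 1) := by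
    funext n; rw [← sub_eq_add_neg]; ring
  have e2 : ∀ n : ℤ, n - -1 = n + 1 := fun n => by ring
  simp only [e2, Int.cast_neg, Int.cast_one] at h1 h2
  rw [e, ← fourierSum_add hd hd', ← mul_fourierSum, ← mul_fourierSum, ← h2]
  simp only [← sub_eq_add_neg]
  rw [← h1, Complex.ofReal_sin, Complex.sin]
  have e3 : -((s * z : ℝ) : ℂ) * Complex.I = Complex.I * (s * -1) * z := by push_cast; ring
  have e4 : ((s * z : ℝ) : ℂ) * Complex.I = Complex.I * (s * 1) * z := by push_cast; ring
  rw [e3, e4, mul_comm (2 : ℂ), ← div_div 1, ← div_div (-1), neg_div, one_div, Complex.inv_I]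
  ring

lemma cos_mul_fourierSum (hw : RapidDecay w) (z : ℝ) :
    ((Real.cos (s * z) : ℝ) : ℂ) * fourierSum r s w z =
      fourierSum r s (fun n => (w (n - 1) + w (n + 1)) / 2) z := by
  have h1 := exp_mul_fourierSum (r := r) (s := s) (w := w) 1 z
  have h2 := exp_mul_fourierSum (r := r) (s := s) (w := w) (-1) z
  have hd : RapidDecay fun n => (1 / 2) * w (n + -1) :=
    (hw.shift (-1)).poly_mul (PolyGrowth.const _)
  have hd' : RapidDecay fun n => (1 / 2) * w (n + 1) :=
    (hw.shift 1).poly_mul (PolyGrowth.const _)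
  have e : (fun n => (w (n - 1) + w (n + 1)) / 2) =
      fun n => (1 / 2) * w (n + -1) + (1 / 2) * w (n + 1) := by
    funext n; rw [← sub_eq_add_neg]; ring
  have e2 : ∀ n : ℤ, n - -1 = n + 1 := fun n => by ring
  simp only [e2, Int.cast_neg, Int.cast_one] at h1 h2
  rw [e, ← fourierSum_add hd hd', ← mul_fourierSum, ← mul_fourierSum, ← h2]
  simp only [← sub_eq_add_neg]
  rw [← h1, Complex.ofReal_cos, Complex.cos]
  have e3 : -((s * z : ℝ) : ℂ) * Complex.I = Complex.I * (s * -1) * z := by push_cast; ring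
  have e4 : ((s * z : ℝ) : ℂ) * Complex.I = Complex.I * (s * 1) * z := by push_cast; ring
  rw [e3, e4]
  ring

lemma fourierSum_add_period (hs : 0 < s) (z : ℝ) :
    fourierSum r s w (z + 2 * Real.pi / s) =
      Complex.exp (2 * Real.pi * Complex.I * r / s) * fourierSum r s w z := by
  have hs' : (s : ℂ) ≠ 0 := by exact_mod_cast hs.ne'
  rw [fourierSum, fourierSum, ← tsum_mul_left]
  refine tsum_congr fun n => ?_
  rw [mul_left_comm, ← Complex.exp_add]
  congr 1
  rw [← Complex.exp_periodic.int_mul n (2 * Real.pi * Complex.I * r / s + _)]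
  congr 1
  push_cast
  field_simp
  ring

lemma fourierSum_add_two_pi (z : ℝ) :
    fourierSum r s w (z + 2 * Real.pi) = fourierSum r s w z := by
  refine tsum_congr fun n => ?_
  congr 1
  rw [← Complex.exp_periodic.int_mul (r + s * n) (Complex.I * (r + s * n) * z)]
  congr 1
  push_cast
  ring

/-- A Fourier series with a nonzero coefficient does not vanish identically. -/
lemma exists_fourierSum_ne_zero (hs : 0 < s) (hw : RapidDecay w) (h0 : w 0 ≠ 0) :
    ∃ z, fourierSum r s w z ≠ 0 := by
  by_contra! hz
  have hint : ∀ n : ℤ, ∫ z in (0 : ℝ)..2 * Real.pi,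
      w n * Complex.exp (Complex.I * (s * n) * z) = if n = 0 then 2 * Real.pi * w 0 else 0 := by
    intro n
    split_ifs with hn
    · subst hn
      simp
    · rw [intervalIntegral.integral_const_mul, integral_exp_mul_complex (by
        simp only [ne_eq, mul_eq_zero, Complex.I_ne_zero, Nat.cast_eq_zero, Int.cast_eq_zero, hn,
          hs.ne', or_self, not_false_eq_true])]
      have : Complex.exp (Complex.I * (s * n) * ((2 * Real.pi : ℝ) : ℂ)) = 1 := by
        rw [← Complex.exp_zero, ← Complex.exp_periodic.int_mul (s * n) 0]
        congr 1
        push_cast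
        ring
      rw [this]
      simp
  have hsum : HasSum (fun n : ℤ => ∫ z in (0 : ℝ)..2 * Real.pi,
      w n * Complex.exp (Complex.I * (s * n) * z))
      (∫ z in (0 : ℝ)..2 * Real.pi, ∑' n : ℤ, w n * Complex.exp (Complex.I * (s * n) * z)) := by
    refine intervalIntegral.hasSum_integral_of_dominated_convergence (fun n _ => ‖w n‖)
      (fun n => ?_) (fun n => ?_) ?_ ?_ ?_
    · exact (Continuous.aestronglyMeasurable (by fun_prop))
    · refine Eventually.of_forall fun z _ => ?_
      have := norm_exp_freq 0 s n z
      rw [Int.cast_zero, zero_add] at this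
      rw [norm_mul, this, mul_one]
    · exact Eventually.of_forall fun z _ => hw.summable_norm
    · exact intervalIntegrable_const
    · refine Eventually.of_forall fun z _ => ?_
      have := hasSum_fourierSum (r := 0) (s := s) hw z
      simp only [Int.cast_zero, zero_add] at this
      exact this.summable.hasSum
  have hzero : ∀ z : ℝ, ∑' n : ℤ, w n * Complex.exp (Complex.I * (s * n) * z) = 0 := by
    intro z
    have h1 := hz z
    have : fourierSum r s w z = Complex.exp (Complex.I * r * z) *
        ∑' n : ℤ, w n * Complex.exp (Complex.I * (s * n) * z) := by
      rw [fourierSum, ← tsum_mul_left]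
      refine tsum_congr fun n => ?_
      rw [mul_left_comm, ← Complex.exp_add]
      ring_nf
    rw [this] at h1
    exact (mul_eq_zero.1 h1).resolve_left (Complex.exp_ne_zero _)
  simp only [hzero, hint, intervalIntegral.integral_zero] at hsum
  have := hsum.unique (hasSum_ite_eq (0 : ℤ) (2 * Real.pi * w 0))
  have hpi : (Real.pi : ℂ) ≠ 0 := by exact_mod_cast Real.pi_ne_zero
  simp [hpi, h0] at this

end

/-! ### Calculus of Fourier modes -/

section General

variable {F : Type*} [NormedAddCommGroup F] [NormedSpace ℝ F]

lemma laplacian_eq_sum_pd {g : E3 → F} (hg : ContDiff ℝ 2 g) (x : E3) :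
    Laplacian.laplacian g x = ∑ j, pd j (pd j g) x := by
  rw [InnerProductSpace.laplacian_eq_iteratedFDeriv_orthonormalBasis g
    (EuclideanSpace.basisFun (Fin 3) ℝ)]
  refine Finset.sum_congr rfl fun j _ => ?_
  have hd : DifferentiableAt ℝ (fderiv ℝ g) x :=
    (hg.fderiv_right (m := 1) (by norm_num)).differentiable (by norm_num) x
  rw [iteratedFDeriv_two_apply]
  unfold pd
  rw [fderiv_clm_apply hd (differentiableAt_const _)]
  simp

/-- The partial derivative is the derivative along the corresponding coordinate line. -/
lemma pd_eq_of_hasDerivAt {g : E3 → F} {x : E3} {j : Fin 3} {g' : F} (hg : DifferentiableAt ℝ g x)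
    (h : HasDerivAt (fun τ : ℝ => g (x + τ • EuclideanSpace.single j (1 : ℝ))) g' 0) :
    pd j g x = g' := by
  rw [pd, ← hg.lineDeriv_eq_fderiv]
  exact h.deriv

lemma contDiff_coord (j : Fin 3) {n : WithTop ℕ∞} : ContDiff ℝ n fun x : E3 => x j := by
  fun_prop

lemma pd_comp_coord {g : ℝ → F} {g' : F} {x : E3} (hg : HasDerivAt g g' (x 2)) (j : Fin 3) :
    pd j (fun y : E3 => g (y 2)) x = if j = 2 then g' else 0 := by
  have hd : DifferentiableAt ℝ (fun y : E3 => g (y 2)) x :=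
    DifferentiableAt.comp x hg.differentiableAt
      ((contDiff_coord 2 (n := 1)).differentiable (by norm_num) x)
  apply pd_eq_of_hasDerivAt hd
  split_ifs with hj
  · subst hj
    have : HasDerivAt (fun τ : ℝ => x 2 + τ) 1 0 := (hasDerivAt_id 0).const_add _
    have h2 := HasDerivAt.scomp (h := fun τ : ℝ => x 2 + τ) (h' := 1) 0 (by simpa using hg) this
    simpa [Function.comp_def] using h2
  · have : ∀ τ : ℝ, (x + τ • EuclideanSpace.single j (1 : ℝ)) 2 = x 2 := fun τ => by
      simp [Ne.symm hj]
    simp only [this]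
    exact hasDerivAt_const _ _

end General

section Mode

variable {a b : ℤ} {c : ℂ} {g : ℝ → ℂ}

lemma contDiff_mode {n : WithTop ℕ∞} (hg : ContDiff ℝ n g) (t : ℝ) :
    ContDiff ℝ n (mode a b c g t) := by
  have h : ∀ j : Fin 3, ContDiff ℝ n fun x : E3 => (x j : ℂ) := fun j =>
    Complex.ofRealCLM.contDiff.comp (contDiff_coord j)
  have h0 := h 0
  have h1 := h 1
  exact (hg.comp (contDiff_coord 2)).mul (by fun_prop)

lemma differentiable_mode (hg : Differentiable ℝ g) (t : ℝ) :
    Differentiable ℝ (mode a b c g t) := by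
  have h : ∀ j : Fin 3, Differentiable ℝ fun x : E3 => (x j : ℂ) := fun j =>
    (Complex.ofRealCLM.contDiff.comp (contDiff_coord j (n := 1))).differentiable (by norm_num)
  have h0 := h 0
  have h1 := h 1
  exact (hg.comp ((contDiff_coord 2 (n := 1)).differentiable (by norm_num))).mul (by fun_prop)

lemma isSmoothOnTorus_mode (hg : ContDiff ℝ ((⊤ : ℕ∞) : WithTop ℕ∞) g)
    (hper : ∀ z, g (z + 2 * Real.pi) = g z) (t : ℝ) : IsSmoothOnTorus (mode a b c g t) := by
  refine ⟨contDiff_mode hg t, fun j x => ?_⟩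
  fin_cases j
  · simp only [mode, Fin.zero_eta, PiLp.add_apply, PiLp.single_apply]
    simp only [Fin.isValue, Fin.reduceEq, reduceIte, add_zero, Complex.ofReal_add,
      Complex.ofReal_mul, Complex.ofReal_ofNat]
    congr 1
    rw [← Complex.exp_periodic.int_mul a (Complex.I * (a * (x 0 : ℂ) + b * (x 1 : ℂ) - a * c * t))]
    congr 1
    ring
  · simp only [mode, Fin.mk_one, PiLp.add_apply, PiLp.single_apply]
    simp only [Fin.isValue, Fin.reduceEq, reduceIte, add_zero, Complex.ofReal_add,
      Complex.ofReal_mul, Complex.ofReal_ofNat]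
    congr 1
    rw [← Complex.exp_periodic.int_mul b (Complex.I * (a * (x 0 : ℂ) + b * (x 1 : ℂ) - a * c * t))]
    congr 1
    ring
  · simp [mode, hper]

lemma pd_zero_mode (hg : Differentiable ℝ g) (t : ℝ) (x : E3) :
    pd 0 (mode a b c g t) x = mode a b c (fun z => Complex.I * a * g z) t x := by
  apply pd_eq_of_hasDerivAt (differentiable_mode hg t x)
  have e : (fun τ : ℝ => mode a b c g t (x + τ • EuclideanSpace.single 0 (1 : ℝ))) = fun τ : ℝ =>
      g (x 2) * Complex.exp (Complex.I * (a * ((x 0 : ℂ) + (τ : ℂ)) + b * (x 1 : ℂ) - a * c * t)) := by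
    funext τ
    simp [mode]
  have h1 : HasDerivAt (fun τ : ℝ => ((x 0 : ℂ) + (τ : ℂ))) 1 0 := by
    simpa using (Complex.ofRealCLM.hasDerivAt (x := 0)).const_add (x 0 : ℂ)
  rw [e]
  convert! ((((h1.const_mul (a : ℂ)).add_const (b * (x 1 : ℂ))).sub_const (a * c * t : ℂ)).const_mul
    Complex.I).cexp.const_mul (g (x 2)) using 1
  simp only [mode, Complex.ofReal_zero, add_zero]
  ring

lemma pd_one_mode (hg : Differentiable ℝ g) (t : ℝ) (x : E3) :
    pd 1 (mode a b c g t) x = mode a b c (fun z => Complex.I * b * g z) t x := by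
  apply pd_eq_of_hasDerivAt (differentiable_mode hg t x)
  have e : (fun τ : ℝ => mode a b c g t (x + τ • EuclideanSpace.single 1 (1 : ℝ))) = fun τ : ℝ =>
      g (x 2) * Complex.exp (Complex.I * (a * (x 0 : ℂ) + b * ((x 1 : ℂ) + (τ : ℂ)) - a * c * t)) := by
    funext τ
    simp [mode]
  have h1 : HasDerivAt (fun τ : ℝ => ((x 1 : ℂ) + (τ : ℂ))) 1 0 := by
    simpa using (Complex.ofRealCLM.hasDerivAt (x := 0)).const_add (x 1 : ℂ)
  rw [e]
  convert! ((((h1.const_mul (b : ℂ)).const_add (a * (x 0 : ℂ))).sub_const (a * c * t : ℂ)).const_mul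
    Complex.I).cexp.const_mul (g (x 2)) using 1
  simp only [mode, Complex.ofReal_zero, add_zero]
  ring

lemma pd_two_mode {g' : ℝ → ℂ} (hg : ∀ z, HasDerivAt g (g' z) z) (t : ℝ) (x : E3) :
    pd 2 (mode a b c g t) x = mode a b c g' t x := by
  apply pd_eq_of_hasDerivAt (differentiable_mode (fun z => (hg z).differentiableAt) t x)
  have e : (fun τ : ℝ => mode a b c g t (x + τ • EuclideanSpace.single 2 (1 : ℝ))) = fun τ : ℝ =>
      g (x 2 + τ) * Complex.exp (Complex.I * (a * (x 0 : ℂ) + b * (x 1 : ℂ) - a * c * t)) := by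
    funext τ
    simp [mode]
  have h1 : HasDerivAt (fun τ : ℝ => x 2 + τ) 1 0 := (hasDerivAt_id 0).const_add _
  have h2 := HasDerivAt.scomp (h := fun τ : ℝ => x 2 + τ) (h' := 1) 0 (by simpa using hg (x 2)) h1
  rw [e]
  simpa [Function.comp_def, mode] using h2.mul_const
    (Complex.exp (Complex.I * (a * (x 0 : ℂ) + b * (x 1 : ℂ) - a * c * t)))

lemma laplacian_mode {g' g'' : ℝ → ℂ} (hg : ∀ z, HasDerivAt g (g' z) z)
    (hg' : ∀ z, HasDerivAt g' (g'' z) z) (hc : ContDiff ℝ 2 g) (t : ℝ) (x : E3) :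
    Laplacian.laplacian (mode a b c g t) x =
      mode a b c (fun z => g'' z - ((a : ℂ) ^ 2 + (b : ℂ) ^ 2) * g z) t x := by
  have hd : Differentiable ℝ g := fun z => (hg z).differentiableAt
  rw [laplacian_eq_sum_pd (contDiff_mode hc t), Fin.sum_univ_three,
    show pd 0 (mode a b c g t) = _ from funext (pd_zero_mode hd t),
    show pd 1 (mode a b c g t) = _ from funext (pd_one_mode hd t),
    show pd 2 (mode a b c g t) = _ from funext (pd_two_mode hg t),
    pd_zero_mode (hd.const_mul _), pd_one_mode (hd.const_mul _), pd_two_mode hg']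
  simp only [mode]
  linear_combination (g (x 2) * ((a : ℂ) ^ 2 + (b : ℂ) ^ 2) *
    Complex.exp (Complex.I * (a * (x 0 : ℂ) + b * (x 1 : ℂ) - a * c * t))) * Complex.I_sq

lemma hasDerivAt_mode_time (t : ℝ) (x : E3) :
    HasDerivAt (fun τ => mode a b c g τ x) (-(Complex.I * a * c * mode a b c g t x)) t := by
  have h1 : HasDerivAt (fun τ : ℝ => Complex.I * (a * (x 0 : ℂ) + b * (x 1 : ℂ) - a * c * (τ : ℂ)))
      (Complex.I * -(a * c * 1)) t :=
    ((((Complex.ofRealCLM.hasDerivAt (x := t)).const_mul (a * c : ℂ))).const_sub _).const_mul _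
  convert! h1.cexp.const_mul (g (x 2)) using 1
  simp only [mode]
  ring

/-- A mode with nonzero first wave number has zero mean. -/
lemma integral_mode_eq_zero (ha : a ≠ 0) (t : ℝ) :
    ∫ x in {x : E3 | ∀ i, x i ∈ Set.Icc 0 (2 * Real.pi)}, mode a b c g t x = 0 := by
  have hset : {x : E3 | ∀ i, x i ∈ Set.Icc 0 (2 * Real.pi)} =
      (@WithLp.ofLp 2 (Fin 3 → ℝ)) ⁻¹' Set.pi Set.univ fun _ => Set.Icc 0 (2 * Real.pi) := by
    ext x; simp only [Set.mem_ofPred_eq, Set.mem_preimage, Set.mem_pi, Set.mem_univ, true_imp_iff]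
  set f : Fin 3 → ℝ → ℂ := ![fun y => Complex.exp (Complex.I * a * y),
    fun y => Complex.exp (Complex.I * b * y),
    fun y => g y * Complex.exp (-(Complex.I * a * c * t))] with hf
  have hprod : ∀ x : E3, mode a b c g t x = ∏ i, f i (x.ofLp i) := by
    intro x
    simp only [hf, Fin.prod_univ_three, mode, Matrix.cons_val_zero, Matrix.cons_val_one,
      Matrix.cons_val]
    rw [mul_left_comm, ← Complex.exp_add, ← Complex.exp_add]
    congr 2
    ring
  simp only [hprod]
  rw [hset, (PiLp.volume_preserving_ofLp (Fin 3)).setIntegral_preimage_emb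
    (MeasurableEquiv.toLp 2 (Fin 3 → ℝ)).symm.measurableEmbedding (fun y => ∏ i, f i (y i)),
    volume_pi, Measure.restrict_pi_pi, integral_fintype_prod_eq_prod]
  refine Finset.prod_eq_zero (Finset.mem_univ 0) ?_
  rw [integral_Icc_eq_integral_Ioc, ← intervalIntegral.integral_of_le (by positivity)]
  simp only [hf, Matrix.cons_val_zero]
  rw [integral_exp_mul_complex (by simp [ha])]
  have : Complex.exp (Complex.I * a * ((2 * Real.pi : ℝ) : ℂ)) = 1 := by
    rw [← Complex.exp_zero, ← Complex.exp_periodic.int_mul a 0]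
    congr 1
    push_cast
    ring
  rw [this]
  simp

end Mode

/-! ### From Fourier coefficients to unstable solutions -/

/-- The `n`-th wave number `r + s n` in the vertical direction. -/
noncomputable def vertFreq (s : ℕ) (r n : ℤ) : ℝ := r + s * n

/-- The squared length `a² + b² + (r + s n)²` of the `n`-th wave vector; `-Δ` acts on the
corresponding Fourier mode as multiplication by it. -/
noncomputable def waveSq (s : ℕ) (a b r n : ℤ) : ℝ :=
  (a : ℝ) ^ 2 + (b : ℝ) ^ 2 + vertFreq s r n ^ 2

/-- The components of the `n`-th wave vector. -/
noncomputable def waveVec (s : ℕ) (a b r : ℤ) (j : Fin 3) (n : ℤ) : ℝ :=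
  if j = 0 then a else if j = 1 then b else vertFreq s r n

/-- The vector `e` of Fourier coefficients of the filtered perturbation and the (rotated) pressure
coefficients `R = i q` solve the linearized equations with growth rate `σ`, in the stationary flow
with filtered velocity `(A sin (s x₃), 0, 0)`. -/
structure IsCoeffSolution (ν α A σ : ℝ) (s : ℕ) (a b r : ℤ) (e : Fin 3 → ℤ → ℝ) (R : ℤ → ℝ) :
    Prop where
  rapid : ∀ j, RapidDecay (e j)
  rapid_pressure : RapidDecay R
  nonzero : e 2 0 ≠ 0
  div_eq_zero : ∀ n, ∑ j, waveVec s a b r j n * e j n = 0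
  momentum : ∀ j n, a * A / 2 * (e j (n - 1) - e j (n + 1)) +
    (if j = 0 then A * s / 2 * (e 2 (n - 1) + e 2 (n + 1)) else 0) +
    (σ + ν * waveSq s a b r n) * (1 + α ^ 2 * waveSq s a b r n) * e j n +
    waveVec s a b r j n * R n = 0

section

variable {s : ℕ} {a b r : ℤ} {c : ℂ} {w : ℤ → ℂ}

lemma polyGrowth_vertFreq (s : ℕ) (r : ℤ) : PolyGrowth (vertFreq s r) :=
  (PolyGrowth.const _).add ((PolyGrowth.const _).mul PolyGrowth.intCast)

lemma PolyGrowth.ofReal {m : ℤ → ℝ} (h : PolyGrowth m) : PolyGrowth fun n => (m n : ℂ) := by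
  obtain ⟨C, j, hC⟩ := h
  exact ⟨C, j, fun n => by simpa using hC n⟩

lemma RapidDecay.ofReal {m : ℤ → ℝ} (h : RapidDecay m) : RapidDecay fun n => (m n : ℂ) :=
  h.of_norm_eq fun n => by simp

lemma polyGrowth_waveSq (s : ℕ) (a b r : ℤ) : PolyGrowth (waveSq s a b r) := by
  have h := (polyGrowth_vertFreq s r).mul (polyGrowth_vertFreq s r)
  convert! (PolyGrowth.const ((a : ℝ) * a + (b : ℝ) * b)).add h using 1
  funext n
  simp only [waveSq]
  ring

lemma polyGrowth_filterSymbol (α : ℝ) (s : ℕ) (a b r : ℤ) :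
    PolyGrowth fun n => ((1 + α ^ 2 * waveSq s a b r n : ℝ) : ℂ) :=
  ((PolyGrowth.const _).add ((PolyGrowth.const _).mul (polyGrowth_waveSq s a b r))).ofReal

lemma polyGrowth_waveVec (s : ℕ) (a b r : ℤ) (j : Fin 3) : PolyGrowth (waveVec s a b r j) := by
  unfold waveVec
  split_ifs
  · exact PolyGrowth.const _
  · exact PolyGrowth.const _
  · exact polyGrowth_vertFreq s r

lemma pd_mode_fourierSum (hw : RapidDecay w) (j : Fin 3) (t : ℝ) (x : E3) :
    pd j (mode a b c (fourierSum r s w) t) x =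
      mode a b c (fourierSum r s fun n => Complex.I * waveVec s a b r j n * w n) t x := by
  have hd : Differentiable ℝ (fourierSum r s w) := fun z =>
    (hasDerivAt_fourierSum hw z).differentiableAt
  fin_cases j
  · simpa [waveVec, mul_fourierSum] using pd_zero_mode hd t x
  · simpa [waveVec, mul_fourierSum] using pd_one_mode hd t x
  · simpa [waveVec, vertFreq] using pd_two_mode (fun z => hasDerivAt_fourierSum hw z) t x

lemma laplacian_mode_fourierSum (hw : RapidDecay w) (t : ℝ) (x : E3) :
    Laplacian.laplacian (mode a b c (fourierSum r s w) t) x =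
      mode a b c (fourierSum r s fun n => -waveSq s a b r n * w n) t x := by
  have hw' := hw.poly_mul (polyGrowth_freq r s)
  have hw'' := hw'.poly_mul (polyGrowth_freq r s)
  rw [laplacian_mode (fun z => hasDerivAt_fourierSum hw z) (fun z => hasDerivAt_fourierSum hw' z)
    (by exact_mod_cast contDiff_infty.1 (contDiff_fourierSum hw) 2)]
  congr 1
  funext z
  rw [sub_eq_add_neg, ← neg_mul, mul_fourierSum,
    fourierSum_add hw'' (hw.poly_mul (PolyGrowth.const _))]
  congr 1
  funext n
  simp only [waveSq, vertFreq]
  push_cast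
  linear_combination ((r + s * n : ℂ) ^ 2 * w n) * Complex.I_sq

lemma isSmoothOnTorus_mode_fourierSum (hw : RapidDecay w) (t : ℝ) :
    IsSmoothOnTorus (mode a b c (fourierSum r s w) t) :=
  isSmoothOnTorus_mode (contDiff_fourierSum hw) (fun z => fourierSum_add_two_pi z) t

/-- The filter `(I - α²Δ)⁻¹` divides Fourier coefficients by `1 + α² |k|²`. -/
lemma isFilterOf_mode_fourierSum (α : ℝ) (hw : RapidDecay w) (t : ℝ) :
    IsFilterOf α
      (mode a b c (fourierSum r s fun n => ((1 + α ^ 2 * waveSq s a b r n : ℝ) : ℂ) * w n) t)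
      (mode a b c (fourierSum r s w) t) := by
  refine ⟨isSmoothOnTorus_mode_fourierSum hw t, fun x => ?_⟩
  have hK : RapidDecay fun n => -(waveSq s a b r n : ℂ) * w n := by
    refine hw.poly_mul ?_
    simpa using (PolyGrowth.const (-1 : ℂ)).mul (polyGrowth_waveSq s a b r).ofReal
  rw [laplacian_mode_fourierSum hw]
  have : fourierSum r s (fun n => ((1 + α ^ 2 * waveSq s a b r n : ℝ) : ℂ) * w n) (x 2) =
      fourierSum r s w (x 2) + -(α : ℂ) ^ 2 *
        fourierSum r s (fun n => -(waveSq s a b r n : ℂ) * w n) (x 2) := by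
    rw [mul_fourierSum, fourierSum_add hw (hK.poly_mul (PolyGrowth.const _))]
    congr 1
    funext n
    push_cast
    ring
  simp only [mode]
  rw [this, Complex.real_smul]
  push_cast
  ring

variable {ν α A σ : ℝ} {e : Fin 3 → ℤ → ℝ} {R : ℤ → ℝ}

/-- The momentum equations in Fourier space say that the modes are eigenfunctions of `L₃`. -/
lemma L3_mode_fourierSum (h : IsCoeffSolution ν α A σ s a b r e R) {U : E3 → ℝ}
    (hU : ∀ x, U x = A * Real.sin (s * x 2)) (t : ℝ) (j : Fin 3) (x : E3) :
    L3 ν U (fun j => mode a b c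
        (fourierSum r s fun n => ((1 + α ^ 2 * waveSq s a b r n : ℝ) : ℂ) * e j n) t)
      (fun j => mode a b c (fourierSum r s fun n => (e j n : ℂ)) t)
      (mode a b c (fourierSum r s fun n => -Complex.I * R n) t) j x =
    -σ * mode a b c
        (fourierSum r s fun n => ((1 + α ^ 2 * waveSq s a b r n : ℝ) : ℂ) * e j n) t x := by
  have he := fun j => (h.rapid j).ofReal
  have hK := polyGrowth_filterSymbol α s a b r
  have hK' : PolyGrowth fun n => -(waveSq s a b r n : ℂ) := by
    simpa using (PolyGrowth.const (-1 : ℂ)).mul (polyGrowth_waveSq s a b r).ofReal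
  have hW := fun j => (he j).poly_mul hK
  have hR : RapidDecay fun n => -Complex.I * R n :=
    h.rapid_pressure.ofReal.poly_mul (PolyGrowth.const _)
  have hξ : ∀ j, PolyGrowth fun n => Complex.I * (waveVec s a b r j n : ℂ) := fun j =>
    (PolyGrowth.const _).mul (polyGrowth_waveVec s a b r j).ofReal
  have hU' : pd 2 U x = A * (Real.cos (s * x 2) * s) := by
    have h1 : HasDerivAt (fun z : ℝ => A * Real.sin (s * z)) (A * (Real.cos (s * x 2) * s))
        (x 2) := by
      simpa using (((hasDerivAt_id (x 2)).const_mul (s : ℝ)).sin).const_mul A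
    rw [show U = fun y : E3 => A * Real.sin (s * y 2) from funext hU, pd_comp_coord h1, if_pos rfl]
  set p₁ : ℤ → ℂ := fun n => (Complex.I * waveVec s a b r 0 (n - 1) * e j (n - 1) -
    Complex.I * waveVec s a b r 0 (n + 1) * e j (n + 1)) / (2 * Complex.I) with hp₁
  set p₂ : ℤ → ℂ := fun n => ((e 2 (n - 1) : ℂ) + e 2 (n + 1)) / 2 with hp₂
  have hp₁r : RapidDecay p₁ := by
    have h1 := ((he j).shift (-1)).poly_mul (PolyGrowth.const ((a : ℂ) / 2))
    have h2 := ((he j).shift 1).poly_mul (PolyGrowth.const (-(a : ℂ) / 2))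
    convert! h1.add h2 using 1
    funext n
    simp only [hp₁, waveVec, if_true, ← sub_eq_add_neg]
    field_simp
    push_cast
    ring
  have hp₂r : RapidDecay p₂ := by
    have h1 := ((he 2).shift (-1)).poly_mul (PolyGrowth.const (1 / 2 : ℂ))
    have h2 := ((he 2).shift 1).poly_mul (PolyGrowth.const (1 / 2 : ℂ))
    convert! h1.add h2 using 1
    funext n
    simp only [hp₂, ← sub_eq_add_neg]
    ring
  have key : (A : ℂ) * fourierSum r s p₁ (x 2) +
      ((if j = 0 then (A * s : ℂ) else 0) * fourierSum r s p₂ (x 2) +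
      (-(ν : ℂ) * fourierSum r s (fun n => -(waveSq s a b r n : ℂ) *
        (((1 + α ^ 2 * waveSq s a b r n : ℝ) : ℂ) * e j n)) (x 2) +
      fourierSum r s (fun n => Complex.I * waveVec s a b r j n * (-Complex.I * R n)) (x 2))) =
      -(σ : ℂ) * fourierSum r s
        (fun n => ((1 + α ^ 2 * waveSq s a b r n : ℝ) : ℂ) * e j n) (x 2) := by
    have r1 := hp₁r.poly_mul (PolyGrowth.const (A : ℂ))
    have r2 := hp₂r.poly_mul (PolyGrowth.const (if j = 0 then (A * s : ℂ) else 0))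
    have r3 := ((hW j).poly_mul hK').poly_mul (PolyGrowth.const (-(ν : ℂ)))
    have r4 := hR.poly_mul (hξ j)
    rw [mul_fourierSum, mul_fourierSum, mul_fourierSum, mul_fourierSum, fourierSum_add r3 r4,
      fourierSum_add r2 (r3.add r4), fourierSum_add r1 (r2.add (r3.add r4))]
    congr 1
    funext n
    have hm := congrArg (fun y : ℝ => (y : ℂ)) (h.momentum j n)
    have e1 : p₁ n = a / 2 * ((e j (n - 1) : ℂ) - e j (n + 1)) := by
      simp only [hp₁, waveVec, if_true]
      field_simp
      push_cast
      ring
    rw [e1]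
    simp only [hp₂]
    split_ifs at hm ⊢
    · push_cast at hm ⊢
      linear_combination hm - (waveVec s a b r j n * R n : ℂ) * Complex.I_sq
    · push_cast at hm ⊢
      linear_combination hm - (waveVec s a b r j n * R n : ℂ) * Complex.I_sq
  simp only [L3]
  rw [pd_mode_fourierSum (he j), laplacian_mode_fourierSum (hW j), pd_mode_fourierSum hR, hU, hU']
  simp only [mode]
  have hs1 := sin_mul_fourierSum (r := r) (s := s) ((he j).poly_mul (hξ 0)) (x 2)
  have hs2 := cos_mul_fourierSum (r := r) (s := s) (he 2) (x 2)
  rw [← hp₁] at hs1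
  rw [← hp₂] at hs2
  rw [← hs1, ← hs2] at key
  set E := Complex.exp (Complex.I * (a * (x 0 : ℂ) + b * (x 1 : ℂ) - a * c * t))
  split_ifs at key ⊢
  · push_cast at key ⊢
    linear_combination E * key
  · push_cast at key ⊢
    linear_combination E * key

lemma isAdmissible_mode_fourierSum (h : IsCoeffSolution ν α A σ s a b r e R) (ha : a ≠ 0) (t : ℝ) :
    IsAdmissible fun j => mode a b c
      (fourierSum r s fun n => ((1 + α ^ 2 * waveSq s a b r n : ℝ) : ℂ) * e j n) t := by
  have hK := polyGrowth_filterSymbol α s a b r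
  have hW := fun j => (h.rapid j).ofReal.poly_mul hK
  have hξ : ∀ j, PolyGrowth fun n => Complex.I * (waveVec s a b r j n : ℂ) := fun j =>
    (PolyGrowth.const _).mul (polyGrowth_waveVec s a b r j).ofReal
  refine ⟨fun j => isSmoothOnTorus_mode_fourierSum (hW j) t, fun x => ?_,
    fun j => integral_mode_eq_zero ha t⟩
  have r' := fun j => (hW j).poly_mul (hξ j)
  simp only [pd_mode_fourierSum (hW _), mode, ← Finset.sum_mul]
  rw [Fin.sum_univ_three, fourierSum_add (r' 0) (r' 1), fourierSum_add ((r' 0).add (r' 1)) (r' 2)]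
  convert! zero_mul _
  rw [fourierSum]
  convert! tsum_zero with n
  have hd := congrArg (fun y : ℝ => (y : ℂ)) (h.div_eq_zero n)
  rw [Fin.sum_univ_three] at hd
  push_cast at hd ⊢
  linear_combination Complex.I * (1 + α ^ 2 * waveSq s a b r n) *
    Complex.exp (Complex.I * (r + s * n) * x 2) * hd

lemma hasUnstableSolution_of_isCoeffSolution (h : IsCoeffSolution ν α A σ s a b r e R)
    (hs : 0 < s) (ha : a ≠ 0) (hσ : 0 < σ) {U : E3 → ℝ}
    (hU : ∀ x, U x = A * Real.sin (s * x 2)) : HasUnstableSolution ν α U s a b r := by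
  have ha' : (a : ℂ) ≠ 0 := by exact_mod_cast ha
  have he := fun j => (h.rapid j).ofReal
  have hK := polyGrowth_filterSymbol α s a b r
  have hW := fun j => (he j).poly_mul hK
  have hR : RapidDecay fun n => -Complex.I * R n :=
    h.rapid_pressure.ofReal.poly_mul (PolyGrowth.const _)
  have hc : Complex.I * a * (Complex.I * σ / a) = -σ := by
    field_simp
    simp
  refine ⟨Complex.I * σ / a,
    fun j => fourierSum r s fun n => ((1 + α ^ 2 * waveSq s a b r n : ℝ) : ℂ) * e j n,
    fourierSum r s fun n => -Complex.I * R n, ?_, fun j z => fourierSum_add_period hs z,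
    fun z => fourierSum_add_period hs z, ?_, ?_⟩
  · rw [hc]; simpa using hσ
  · refine ⟨fun t => isAdmissible_mode_fourierSum h ha t,
      fun t => isSmoothOnTorus_mode_fourierSum hR t,
      fun t j => mode a b _ (fourierSum r s fun n => (e j n : ℂ)) t,
      fun t j => isFilterOf_mode_fourierSum α (he j) t, fun t j x => ?_⟩
    rw [L3_mode_fourierSum h hU, ← hc]
    exact hasDerivAt_mode_time t x
  · refine ⟨isAdmissible_mode_fourierSum h ha 0, fun h0 => ?_,
      isSmoothOnTorus_mode_fourierSum hR 0,
      fun j => mode a b _ (fourierSum r s fun n => (e j n : ℂ)) 0,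
      fun j => isFilterOf_mode_fourierSum α (he j) 0, fun j x => ?_⟩
    · have hne : ((1 + α ^ 2 * waveSq s a b r 0 : ℝ) : ℂ) * (e 2 0 : ℂ) ≠ 0 := by
        have : 0 ≤ waveSq s a b r 0 := by unfold waveSq; positivity
        have h1 : 1 + α ^ 2 * waveSq s a b r 0 ≠ 0 := by positivity
        exact_mod_cast mul_ne_zero h1 h.nonzero
      obtain ⟨z, hz⟩ := exists_fourierSum_ne_zero (r := r) hs (hW 2) hne
      have := congrFun (congrFun h0 2) (EuclideanSpace.single 2 z)
      simp only [mode, Pi.zero_apply, mul_eq_zero, Complex.exp_ne_zero, or_false] at this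
      exact hz (by simpa using this)
    · rw [L3_mode_fourierSum h hU, ← hc]

end

/-! ### The dispersion relation -/

/-- The coefficient of `σ + ν K` in the three-term recurrence for `dₙ = (K - s²) ω̄₃,ₙ`, where `K`
is the squared length of the `n`-th wave vector. -/
noncomputable def dispCoeff (β α : ℝ) (s : ℕ) (a b r n : ℤ) : ℝ :=
  waveSq s a b r n * (1 + α ^ 2 * waveSq s a b r n) / (β * (waveSq s a b r n - (s : ℝ) ^ 2))

section

variable {s : ℕ} {a b r : ℤ}

lemma waveSq_eq_intCast (s : ℕ) (a b r n : ℤ) :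
    waveSq s a b r n = ((a ^ 2 + b ^ 2 + (r + s * n) ^ 2 : ℤ) : ℝ) := by
  simp [waveSq, vertFreq]

lemma one_le_waveSq (ha : 0 < a) (n : ℤ) : 1 ≤ waveSq s a b r n := by
  rw [waveSq_eq_intCast]
  have : 1 ≤ a ^ 2 + b ^ 2 + (r + s * n) ^ 2 := by nlinarith [sq_nonneg b, sq_nonneg (r + s * n)]
  exact_mod_cast this

/-- As `|r| ≤ s / 6` and `s ≥ 1`, the wave number `r + s n` is at least of size `|n|`, up to a
constant. -/
lemma le_waveSq (hs : 0 < s) (ha : 0 < a) (hr : 6 * |(r : ℝ)| ≤ s) (n : ℤ) :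
    (1 + |(n : ℝ)|) / 4 ≤ waveSq s a b r n := by
  have h1 := one_le_waveSq (s := s) (b := b) (r := r) ha n
  have hs' : (1 : ℝ) ≤ s := by exact_mod_cast hs
  rcases eq_or_ne n 0 with rfl | hn
  · norm_num at h1 ⊢
    linarith
  · have hn' : (1 : ℝ) ≤ |(n : ℝ)| := by exact_mod_cast Int.one_le_abs hn
    have h2 : |(n : ℝ)| / 2 ≤ |vertFreq s r n| := by
      have h3 := abs_sub_abs_le_abs_sub ((s : ℝ) * n) (-r)
      rw [abs_neg, abs_mul, Nat.abs_cast, sub_neg_eq_add, add_comm ((s : ℝ) * n)] at h3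
      unfold vertFreq
      nlinarith
    have h4 : |vertFreq s r n| ^ 2 ≤ waveSq s a b r n := by
      rw [sq_abs, waveSq]
      nlinarith [sq_nonneg (a : ℝ), sq_nonneg (b : ℝ)]
    nlinarith

lemma waveSq_sub_one (s : ℕ) (a b r n : ℤ) :
    waveSq s a b r (n - 1) = waveSq s a b r n - 2 * vertFreq s r n * s + (s : ℝ) ^ 2 := by
  simp only [waveSq, vertFreq]
  push_cast
  ring

lemma waveSq_add_one (s : ℕ) (a b r n : ℤ) :
    waveSq s a b r (n + 1) = waveSq s a b r n + 2 * vertFreq s r n * s + (s : ℝ) ^ 2 := by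
  simp only [waveSq, vertFreq]
  push_cast
  ring

lemma one_le_abs_waveSq_sub {n : ℤ} (h : waveSq s a b r n ≠ (s : ℝ) ^ 2) :
    1 ≤ |waveSq s a b r n - (s : ℝ) ^ 2| := by
  rw [waveSq_eq_intCast] at h ⊢
  have h1 : (a ^ 2 + b ^ 2 + (r + s * n) ^ 2 : ℤ) - (s : ℤ) ^ 2 ≠ 0 :=
    sub_ne_zero.2 fun h' => h (by rw [h']; simp)
  exact_mod_cast Int.one_le_abs h1

/-- If the dispersion inequality holds at growth rate zero, there is a growing solution in Fourier
space: the third component comes from the three-term recurrence, the pressure from the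
divergence-free condition, the second component from a coercive system, and the first one is then
determined by the divergence-free condition. -/
lemma exists_isCoeffSolution {ν A : ℝ} (α : ℝ) (hν : 0 < ν) (hA : 0 < A) (hs : 0 < s) (ha : 0 < a)
    (hr : 6 * |(r : ℝ)| ≤ s) (hK₀ : waveSq s a b r 0 < (s : ℝ) ^ 2)
    (hK : ∀ n, n ≠ 0 → (s : ℝ) ^ 2 < waveSq s a b r n)
    (hlt : let c := fun n => dispCoeff (a * A / 2) α s a b r n * (ν * waveSq s a b r n);
      -c 0 < 1 / (c 1 + 1 / c 2) + 1 / (c (-1) + 1 / c (-2))) :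
    ∃ σ > 0, ∃ e R, IsCoeffSolution ν α A σ s a b r e R := by
  have ha' : (0 : ℝ) < a := by exact_mod_cast ha
  set β : ℝ := a * A / 2 with hβ
  have hβ0 : 0 < β := by positivity
  set K : ℤ → ℝ := waveSq s a b r with hKdef
  have hK1 : ∀ n, 1 ≤ K n := one_le_waveSq ha
  have hKpos : ∀ n, 0 < K n := fun n => one_pos.trans_le (hK1 n)
  have hlow : ∀ n : ℤ, (1 + |(n : ℝ)|) / 4 ≤ K n := le_waveSq hs ha hr
  have hne : ∀ n, K n ≠ (s : ℝ) ^ 2 := fun n => by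
    rcases eq_or_ne n 0 with rfl | hn
    · exact hK₀.ne
    · exact (hK n hn).ne'
  have hne' : ∀ n, K n - (s : ℝ) ^ 2 ≠ 0 := fun n => sub_ne_zero.2 (hne n)
  obtain ⟨σ, hσ, d, hd0, hdb, hdrec⟩ := exists_growth_rate (h := dispCoeff β α s a b r)
    (κ := fun n => ν * K n) (fun n => mul_pos hν (hKpos n))
    (div_neg_of_pos_of_neg (by have := hKpos 0; positivity)
      (mul_neg_of_pos_of_neg hβ0 (sub_neg.2 hK₀)))
    (fun n hn => div_pos (by have := hKpos n; positivity) (mul_pos hβ0 (sub_pos.2 (hK n hn)))) hlt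
  -- the recurrence without denominators
  have hrec : ∀ n, K n * (1 + α ^ 2 * K n) * (σ + ν * K n) * d n =
      β * (K n - (s : ℝ) ^ 2) * (d (n + 1) - d (n - 1)) := by
    intro n
    have h1 := hdrec n
    rw [dispCoeff, ← hKdef] at h1
    have := hne' n
    field_simp at h1
    linear_combination h1
  have hd : RapidDecay d := by
    refine rapidDecay_of_bounded (f := fun _ => 0) (κ := ν / 4) (β := β * (1 + (s : ℝ) ^ 2))
      (by positivity) (by positivity) (fun k => ⟨0, fun n => by simp⟩) hdb fun n => ?_
    have h1 := congrArg abs (hrec n)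
    have h0 := hKpos n
    rw [abs_mul, abs_mul (_ * _) (_ - _), abs_mul β, abs_of_pos hβ0, abs_of_pos (by positivity)]
      at h1
    have h2 : |K n - (s : ℝ) ^ 2| ≤ K n * (1 + (s : ℝ) ^ 2) := by
      rw [abs_le]
      constructor <;> nlinarith [hK1 n, sq_nonneg (s : ℝ)]
    have h3 : |d (n + 1) - d (n - 1)| ≤ |d (n - 1)| + |d (n + 1)| :=
      (abs_sub _ _).trans_eq (add_comm _ _)
    have h4 : K n * (ν * K n * |d n|) ≤
        K n * (β * (1 + (s : ℝ) ^ 2) * (|d (n - 1)| + |d (n + 1)|)) := by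
      calc K n * (ν * K n * |d n|) = K n * 1 * (ν * K n) * |d n| := by ring
        _ ≤ K n * (1 + α ^ 2 * K n) * (σ + ν * K n) * |d n| := by
          gcongr
          · exact le_add_of_nonneg_right (by positivity)
          · linarith
        _ = _ := h1
        _ ≤ β * (K n * (1 + (s : ℝ) ^ 2)) * (|d (n - 1)| + |d (n + 1)|) := by gcongr
        _ = _ := by ring
    have h5 := le_of_mul_le_mul_left h4 h0
    rw [abs_zero, zero_add]
    calc _ = ν * ((1 + |(n : ℝ)|) / 4) * |d n| := by ring
      _ ≤ ν * K n * |d n| := by gcongr; exact hlow n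
      _ ≤ _ := h5
  set e₃ : ℤ → ℝ := fun n => (K n - (s : ℝ) ^ 2)⁻¹ * d n with he₃
  have he₃r : RapidDecay e₃ := hd.poly_mul ⟨1, 0, fun n => by
    rw [norm_inv, pow_zero, mul_one]
    exact inv_le_one_of_one_le₀ (one_le_abs_waveSq_sub (hne n))⟩
  have hde : ∀ n, d n = (K n - (s : ℝ) ^ 2) * e₃ n := fun n => by
    simp only [he₃]
    rw [mul_inv_cancel_left₀ (hne' n)]
  set R : ℤ → ℝ := fun n => (K n)⁻¹ * (-(2 * β * s) * (e₃ (n - 1) + e₃ (n + 1))) with hR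
  have hRr : RapidDecay R := by
    have h1 := (he₃r.shift (-1)).add (he₃r.shift 1)
    refine RapidDecay.poly_mul (RapidDecay.poly_mul h1 (PolyGrowth.const _)) ⟨1, 0, fun n => ?_⟩
    rw [norm_inv, pow_zero, mul_one, Real.norm_of_nonneg (hKpos n).le]
    exact inv_le_one_of_one_le₀ (hK1 n)
  have hKR : ∀ n, K n * R n = -(2 * β * s) * (e₃ (n - 1) + e₃ (n + 1)) := fun n => by
    simp only [hR]
    rw [mul_inv_cancel_left₀ (hKpos n).ne']
  have hσK : ∀ n, σ + ν * K n ≤ (σ + ν * K n) * (1 + α ^ 2 * K n) := fun n => by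
    have := hKpos n
    exact le_mul_of_one_le_right (by positivity) (le_add_of_nonneg_right (by positivity))
  have hbR : RapidDecay fun n => -(b : ℝ) * R n := hRr.poly_mul (PolyGrowth.const _)
  obtain ⟨e₂, he₂b, he₂⟩ := exists_bounded_solution (g := fun n =>
    (σ + ν * K n) * (1 + α ^ 2 * K n)) β hσ (fun n => by
      have := hσK n
      have := mul_pos hν (hKpos n)
      linarith) hbR.summable_norm.of_norm
  have he₂r : RapidDecay e₂ := by
    refine rapidDecay_of_bounded (κ := ν / 4) (by positivity) hβ0.le hbR he₂b fun n => ?_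
    have h0 := hKpos n
    have h1 : |(σ + ν * K n) * (1 + α ^ 2 * K n) * e₂ n| ≤
        |-(b : ℝ) * R n| + β * (|e₂ (n - 1)| + |e₂ (n + 1)|) := by
      rw [show (σ + ν * K n) * (1 + α ^ 2 * K n) * e₂ n =
        -(b : ℝ) * R n - β * (e₂ (n - 1) - e₂ (n + 1)) by linear_combination he₂ n]
      refine (abs_sub _ _).trans ?_
      rw [abs_mul β, abs_of_pos hβ0]
      gcongr
      exact abs_sub _ _
    rw [abs_mul, abs_of_pos (by positivity)] at h1
    refine le_trans (mul_le_mul_of_nonneg_right ?_ (abs_nonneg _)) h1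
    have := hσK n
    nlinarith [hlow n]
  have hvf := polyGrowth_vertFreq s r
  set e₁ : ℤ → ℝ := fun n => -(a : ℝ)⁻¹ * ((b : ℝ) * e₂ n + vertFreq s r n * e₃ n) with he₁
  have he₁r : RapidDecay e₁ :=
    ((he₂r.poly_mul (PolyGrowth.const _)).add (he₃r.poly_mul hvf)).poly_mul (PolyGrowth.const _)
  have hdiv : ∀ n, (a : ℝ) * e₁ n = -(b * e₂ n + vertFreq s r n * e₃ n) := fun n => by
    simp only [he₁]
    field_simp
  have hm3 : ∀ n, β * (e₃ (n - 1) - e₃ (n + 1)) +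
      (σ + ν * K n) * (1 + α ^ 2 * K n) * e₃ n + vertFreq s r n * R n = 0 := by
    intro n
    have h1 := hrec n
    rw [hde n, hde (n - 1), hde (n + 1), hKdef, waveSq_sub_one, waveSq_add_one, ← hKdef] at h1
    have h2 : (K n - (s : ℝ) ^ 2) * (K n * (β * (e₃ (n - 1) - e₃ (n + 1)) +
      (σ + ν * K n) * (1 + α ^ 2 * K n) * e₃ n + vertFreq s r n * R n)) = 0 := by
      linear_combination h1 + (K n - (s : ℝ) ^ 2) * vertFreq s r n * hKR n
    exact ((mul_eq_zero.1 h2).resolve_left (hne' n) |> mul_eq_zero.1).resolve_left (hKpos n).ne'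
  refine ⟨σ, hσ, ![e₁, e₂, e₃], R, ?_, hRr, ?_, fun n => ?_, fun j n => ?_⟩
  · intro j; fin_cases j
    exacts [he₁r, he₂r, he₃r]
  · simpa [he₃, hd0] using hne' 0
  · have := hdiv n
    simp [Fin.sum_univ_three, waveVec]
    linarith
  · have h2 := he₂ n
    have h3 := hm3 n
    fin_cases j
    · simp only [waveVec, Fin.zero_eta, if_true, Matrix.cons_val_zero, Matrix.cons_val, ← hβ,
        ← hKdef]
      -- `k · (momentum equations)` reduces to the equation for the pressure
      have hv1 : vertFreq s r (n - 1) = vertFreq s r n - s := by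
        simp only [vertFreq]; push_cast; ring
      have hv2 : vertFreq s r (n + 1) = vertFreq s r n + s := by
        simp only [vertFreq]; push_cast; ring
      have h4 := hdiv (n - 1)
      have h5 := hdiv (n + 1)
      rw [hv1] at h4
      rw [hv2] at h5
      have hKn : K n = (a : ℝ) ^ 2 + (b : ℝ) ^ 2 + vertFreq s r n ^ 2 := rfl
      refine (mul_eq_zero.1 (?_ : (a : ℝ) * _ = 0)).resolve_left ha'.ne'
      linear_combination β * h4 - β * h5 + (σ + ν * K n) * (1 + α ^ 2 * K n) * hdiv n - b * h2 -
        vertFreq s r n * h3 + hKR n - R n * hKn - (e₃ (n - 1) + e₃ (n + 1)) * s * hβ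
    · simp [waveVec, ← hβ, ← hKdef]
      linarith
    · simp [waveVec, ← hβ, ← hKdef]
      linarith

end

/-- The elementary estimate behind the instability: with `K₀ < s² / 3` and the coefficients of the
recurrence at the neighbouring wave vectors (on the side where the vertical wave number does not
decrease in size), the dispersion inequality holds as soon as the amplitude `M` is large. -/
lemma dispersion_estimate {K₀ S ρ δ α M : ℝ} (hS : 0 < S) (hδ : 0 < δ) (hM : 0 < M)
    (hK : δ ^ 2 * S ^ 2 ≤ K₀) (hK' : K₀ < S ^ 2 / 3) (hρ : 0 ≤ ρ) (hρ' : 6 * ρ ≤ S)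
    (hamp : 15 * (S ^ 2 * (1 + α ^ 2 * S ^ 2)) ^ 2 ≤ 8 * (δ * M) ^ 2)
    {K₁ K₂ : ℝ} (hK₁ : K₁ = K₀ + 2 * ρ * S + S ^ 2) (hK₂ : K₂ = K₀ + 4 * ρ * S + 4 * S ^ 2) :
    K₀ ^ 2 * (1 + α ^ 2 * K₀) / (S ^ 2 - K₀) / M <
      1 / (K₁ ^ 2 * (1 + α ^ 2 * K₁) / (K₁ - S ^ 2) / M +
        1 / (K₂ ^ 2 * (1 + α ^ 2 * K₂) / (K₂ - S ^ 2) / M)) := by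
  have hK0 : 0 < K₀ := lt_of_lt_of_le (by positivity) hK
  have hS2 : 0 < S ^ 2 := by positivity
  have hρS : 0 ≤ ρ * S := by positivity
  have hρS' : 6 * (ρ * S) ≤ S ^ 2 := by nlinarith
  have hd : S ^ 2 * δ ^ 2 ≤ K₁ - S ^ 2 := by rw [hK₁]; linarith
  have hd0 : 0 < K₁ - S ^ 2 := lt_of_lt_of_le (by positivity) hd
  have hK1 : 0 < K₁ := by rw [hK₁]; positivity
  have hK1' : K₁ ≤ 5 / 3 * S ^ 2 := by rw [hK₁]; linarith
  have hK2 : 4 * S ^ 2 ≤ K₂ := by rw [hK₂]; linarith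
  have hK20 : 0 < K₂ := lt_of_lt_of_le (by positivity) hK2
  have hK2' : 0 < K₂ - S ^ 2 := by linarith
  set y : ℝ := α ^ 2 * S ^ 2 with hy
  have hy0 : 0 ≤ y := by positivity
  have hα : 0 ≤ α ^ 2 := sq_nonneg α
  set E₀ := K₀ ^ 2 * (1 + α ^ 2 * K₀) / (S ^ 2 - K₀) with hE₀
  set E₁ := K₁ ^ 2 * (1 + α ^ 2 * K₁) / (K₁ - S ^ 2) with hE₁
  set E₂ := K₂ ^ 2 * (1 + α ^ 2 * K₂) / (K₂ - S ^ 2) with hE₂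
  have hE0 : 0 < E₀ := div_pos (by positivity) (by linarith)
  have hE1 : 0 < E₁ := by positivity
  have hE2 : 0 < E₂ := by positivity
  clear_value E₀ E₁ E₂ y
  have b0 : E₀ ≤ S ^ 2 / 6 * (1 + y / 3) := by
    rw [hE₀, div_le_iff₀ (by linarith)]
    have h1 : K₀ ^ 2 ≤ (S ^ 2 / 3) ^ 2 := by gcongr
    have h2 : 1 + α ^ 2 * K₀ ≤ 1 + y / 3 := by
      linarith [mul_le_mul_of_nonneg_left hK'.le hα]
    calc _ ≤ (S ^ 2 / 3) ^ 2 * (1 + y / 3) := by gcongr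
      _ = S ^ 2 / 6 * (1 + y / 3) * (S ^ 2 - S ^ 2 / 3) := by ring
      _ ≤ _ := by gcongr
  have b1 : E₁ * δ ^ 2 ≤ 25 / 9 * S ^ 2 * (1 + 5 / 3 * y) := by
    have h1 : K₁ ^ 2 ≤ (5 / 3 * S ^ 2) ^ 2 := by gcongr
    have h2 : 1 + α ^ 2 * K₁ ≤ 1 + 5 / 3 * y := by
      linarith [mul_le_mul_of_nonneg_left hK1' hα]
    have h3 : E₁ * (S ^ 2 * δ ^ 2) ≤ (5 / 3 * S ^ 2) ^ 2 * (1 + 5 / 3 * y) := by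
      calc E₁ * (S ^ 2 * δ ^ 2) ≤ E₁ * (K₁ - S ^ 2) := by gcongr
        _ = K₁ ^ 2 * (1 + α ^ 2 * K₁) := by rw [hE₁, div_mul_cancel₀ _ hd0.ne']
        _ ≤ _ := by gcongr
    refine le_of_mul_le_mul_left ?_ (by positivity : 0 < S ^ 2)
    linarith
  have b2 : 4 * E₀ ≤ E₂ := by
    have h1 : 4 * S ^ 2 * (1 + y) ≤ E₂ := by
      rw [hE₂, le_div_iff₀ hK2']
      have h2 : 1 + y ≤ 1 + α ^ 2 * K₂ := by
        linarith [mul_le_mul_of_nonneg_left hK2 hα, mul_nonneg hα hS2.le]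
      calc 4 * S ^ 2 * (1 + y) * (K₂ - S ^ 2) ≤ K₂ * (1 + α ^ 2 * K₂) * K₂ := by
            gcongr
            linarith [sq_nonneg S]
        _ = _ := by ring
    have h2 : S ^ 2 / 6 * (1 + y / 3) ≤ S ^ 2 * (1 + y) := by
      have : 0 ≤ S ^ 2 * y := by positivity
      linarith [hS2]
    linarith
  have b3 : 2 * (E₀ * E₁) ≤ M ^ 2 := by
    have h1 : E₀ * (E₁ * δ ^ 2) ≤
        (S ^ 2 / 6 * (1 + y / 3)) * (25 / 9 * S ^ 2 * (1 + 5 / 3 * y)) :=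
      mul_le_mul b0 b1 (by positivity) (by positivity)
    have h2 : (1 + y / 3) * (1 + 5 / 3 * y) ≤ (1 + y) ^ 2 := by linarith [sq_nonneg y]
    have h3 : (S ^ 2 / 6 * (1 + y / 3)) * (25 / 9 * S ^ 2 * (1 + 5 / 3 * y)) ≤
        25 / 54 * (S ^ 2 * (1 + y)) ^ 2 := by
      calc _ = 25 / 54 * (S ^ 2) ^ 2 * ((1 + y / 3) * (1 + 5 / 3 * y)) := by ring
        _ ≤ 25 / 54 * (S ^ 2) ^ 2 * (1 + y) ^ 2 := by gcongr
        _ = _ := by ring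
    refine le_of_mul_le_mul_left ?_ (by positivity : 0 < δ ^ 2)
    linarith [sq_nonneg (S ^ 2 * (1 + y))]
  have hpos : 0 < E₁ / M + 1 / (E₂ / M) := by positivity
  rw [lt_div_iff₀ hpos]
  have e : E₀ / M * (E₁ / M + 1 / (E₂ / M)) = E₀ * E₁ / M ^ 2 + E₀ / E₂ := by
    field_simp
  have h1 : E₀ * E₁ / M ^ 2 ≤ 1 / 2 := by rw [div_le_iff₀ (by positivity)]; linarith
  have h2 : E₀ / E₂ ≤ 1 / 4 := by rw [div_le_iff₀ hE2]; linarith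
  rw [e]
  linarith

/-! ### Instability in the region `A(δ)` -/

section

variable {ν α A δ : ℝ} {s : ℕ} {a b r : ℤ}

lemma waveSq_gt_of_ne_zero (hr : 6 * |(r : ℝ)| ≤ s)
    (hm : (s : ℝ) ^ 2 < (a : ℝ) ^ 2 + (b : ℝ) ^ 2 + (-s + r) ^ 2)
    (hp : (s : ℝ) ^ 2 < (a : ℝ) ^ 2 + (b : ℝ) ^ 2 + (s + r) ^ 2) (n : ℤ) (hn : n ≠ 0) :
    (s : ℝ) ^ 2 < waveSq s a b r n := by
  have hab : 0 < (a : ℝ) ^ 2 + (b : ℝ) ^ 2 := by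
    by_contra! h0
    have h1 : 0 ≤ (s : ℝ) := s.cast_nonneg
    rcases abs_cases (r : ℝ) with ⟨h2, h3⟩ | ⟨h2, h3⟩ <;> rw [h2] at hr
    · nlinarith
    · nlinarith
  rcases eq_or_ne n 1 with rfl | h1
  · simp only [waveSq, vertFreq, Int.cast_one, mul_one]
    linarith
  rcases eq_or_ne n (-1) with rfl | h2
  · simp only [waveSq, vertFreq, Int.cast_neg, Int.cast_one, mul_neg, mul_one]
    linarith
  have h3 : (2 : ℝ) ≤ |(n : ℝ)| := by
    have : (2 : ℤ) ≤ |n| := by rcases abs_cases n with ⟨h, _⟩ | ⟨h, _⟩ <;> omega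
    exact_mod_cast this
  have h4 : (s : ℝ) ≤ |vertFreq s r n| := by
    have h5 := abs_sub_abs_le_abs_sub ((s : ℝ) * n) (-r)
    rw [abs_neg, abs_mul, Nat.abs_cast, sub_neg_eq_add, add_comm ((s : ℝ) * n)] at h5
    have : (s : ℝ) * 2 ≤ s * |(n : ℝ)| := by gcongr
    unfold vertFreq
    linarith [abs_nonneg (r : ℝ)]
  have h5 : (s : ℝ) ^ 2 ≤ |vertFreq s r n| ^ 2 := by gcongr
  rw [sq_abs] at h5
  rw [waveSq]
  linarith

/-- The geometric conditions of the region `A(δ)` together with a lower bound on the amplitude give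
an unstable solution. -/
lemma hasUnstableSolution_of_amplitude_ge (hν : 0 < ν) (hA : 0 < A) (hδ : 0 < δ) (hs : 0 < s)
    (ha : 0 < a) (hr : 6 * |(r : ℝ)| ≤ s)
    (hK₀ : (a : ℝ) ^ 2 + (b : ℝ) ^ 2 + (r : ℝ) ^ 2 < (s : ℝ) ^ 2 / 3)
    (hm : (s : ℝ) ^ 2 < (a : ℝ) ^ 2 + (b : ℝ) ^ 2 + (-s + r) ^ 2)
    (hp : (s : ℝ) ^ 2 < (a : ℝ) ^ 2 + (b : ℝ) ^ 2 + (s + r) ^ 2)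
    (hδk : δ ^ 2 * (s : ℝ) ^ 2 ≤ (a : ℝ) ^ 2 + (b : ℝ) ^ 2)
    (hamp : 15 * ((s : ℝ) ^ 2 * (1 + α ^ 2 * (s : ℝ) ^ 2)) ^ 2 ≤
      8 * (δ * (a * A / 2 / ν)) ^ 2)
    {U : E3 → ℝ} (hU : ∀ x, U x = A * Real.sin (s * x 2)) :
    HasUnstableSolution ν α U s a b r := by
  have hs' : (0 : ℝ) < s := by exact_mod_cast hs
  have ha' : (0 : ℝ) < a := by exact_mod_cast ha
  have hK := waveSq_gt_of_ne_zero (a := a) (b := b) hr hm hp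
  have hK0 : waveSq s a b r 0 = (a : ℝ) ^ 2 + (b : ℝ) ^ 2 + (r : ℝ) ^ 2 := by
    simp [waveSq, vertFreq]
  have hs2 : 0 < (s : ℝ) ^ 2 := by positivity
  have hKs : waveSq s a b r 0 < (s : ℝ) ^ 2 := by rw [hK0]; linarith
  have hβ : 0 < a * A / 2 := by positivity
  set M : ℝ := a * A / 2 / ν with hM
  have hM0 : 0 < M := by positivity
  have hc : ∀ n, dispCoeff (a * A / 2) α s a b r n * (ν * waveSq s a b r n) =
      waveSq s a b r n ^ 2 * (1 + α ^ 2 * waveSq s a b r n) / (waveSq s a b r n - (s : ℝ) ^ 2) /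
        M := by
    intro n
    rw [dispCoeff, hM]
    field_simp
  have hcpos : ∀ n, n ≠ 0 → 0 < waveSq s a b r n ^ 2 * (1 + α ^ 2 * waveSq s a b r n) /
      (waveSq s a b r n - (s : ℝ) ^ 2) / M := by
    intro n hn
    have h1 := hK n hn
    have h2 : 0 < waveSq s a b r n := hs2.trans h1
    have h3 : 0 < waveSq s a b r n - (s : ℝ) ^ 2 := sub_pos.2 h1
    positivity
  have hc0 : -(waveSq s a b r 0 ^ 2 * (1 + α ^ 2 * waveSq s a b r 0) /
      (waveSq s a b r 0 - (s : ℝ) ^ 2) / M) =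
      waveSq s a b r 0 ^ 2 * (1 + α ^ 2 * waveSq s a b r 0) /
      ((s : ℝ) ^ 2 - waveSq s a b r 0) / M := by
    rw [← neg_div, ← div_neg, neg_sub]
  have hside : ∀ {x y : ℝ}, 0 < x → 0 < y → 0 < 1 / (x + 1 / y) := fun hx hy => by positivity
  have hest := fun {K₁ K₂ : ℝ} => dispersion_estimate (K₀ := waveSq s a b r 0) (ρ := |(r : ℝ)|)
    (α := α) hs' hδ hM0 (by rw [hK0]; linarith [sq_nonneg (r : ℝ)]) (by rw [hK0]; exact hK₀)
    (abs_nonneg _) hr hamp (K₁ := K₁) (K₂ := K₂)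
  obtain ⟨σ, hσ, e, R, h⟩ := exists_isCoeffSolution (A := A) α hν hA hs ha hr hKs hK (by
    simp only [hc]
    rw [hc0]
    -- the neighbour on the side of the sign of `r` is bounded away from the sphere `|k| = s`
    rcases abs_cases (r : ℝ) with ⟨hr1, -⟩ | ⟨hr1, -⟩
    · refine lt_add_of_lt_of_pos (hest ?_ ?_)
        (hside (hcpos (-1) (by norm_num)) (hcpos (-2) (by norm_num)))
      · rw [hr1]; simp only [waveSq, vertFreq]; push_cast; ring
      · rw [hr1]; simp only [waveSq, vertFreq]; push_cast; ring
    · refine lt_add_of_pos_of_lt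
        (hside (hcpos 1 (by norm_num)) (hcpos 2 (by norm_num))) (hest ?_ ?_)
      · rw [hr1]; simp only [waveSq, vertFreq]; push_cast; ring
      · rw [hr1]; simp only [waveSq, vertFreq]; push_cast; ring)
  exact hasUnstableSolution_of_isCoeffSolution h hs ha.ne' hσ hU

end

/-- The amplitude `λ = √2 c₁ s (1 + α² s²)²` is large enough for every admissible triple. -/
lemma hasUnstableSolution_of_mem_triples {δ c₁ c₂ c₃ c₄ ν α : ℝ} {s : ℕ} (hδ : 0 < δ)
    (hc₁ : 110 * √5 * Real.pi / (63 * δ ^ 2) ≤ c₁) (hc₃ : 0 < c₃)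
    (hD : rectD c₂ c₃ c₄ s ⊆ regionA δ s) (hν : 0 < ν) (hs : 0 < s) {a b r : ℤ}
    (h : (a, b, r) ∈ triples c₂ c₃ c₄ s) :
    HasUnstableSolution ν α (u0 ν α (amplitude c₁ α s) s) s a b r := by
  obtain ⟨h1, h2, h3, h4⟩ := h
  simp only at h1 h2 h3 h4
  have hs' : (0 : ℝ) < s := by exact_mod_cast hs
  have hpi := Real.pi_pos
  have hk0 : 0 ≤ (a : ℝ) ^ 2 + (b : ℝ) ^ 2 := by positivity
  obtain ⟨g1, g2, g3, g4, g5, g6⟩ :=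
    hD (show (√((a : ℝ) ^ 2 + (b : ℝ) ^ 2), (r : ℝ)) ∈ rectD c₂ c₃ c₄ s from ⟨h1, h2, h3⟩)
  simp only [Real.sq_sqrt hk0] at g1 g2 g3 g4
  have ha : 0 < a := by
    refine lt_of_le_of_ne ((abs_nonneg b).trans h4) fun h0 => ?_
    have hb : b = 0 := by rw [← h0] at h4; simpa using h4
    rw [← h0, hb] at h1
    have : 0 < c₃ * s := by positivity
    norm_num at h1
    linarith
  have ha' : (0 : ℝ) < a := by exact_mod_cast ha
  have hba : (b : ℝ) ^ 2 ≤ (a : ℝ) ^ 2 := by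
    rw [← sq_abs (b : ℝ)]
    have : |(b : ℝ)| ≤ a := by exact_mod_cast h4
    gcongr
  have hδk : δ ^ 2 * (s : ℝ) ^ 2 ≤ (a : ℝ) ^ 2 + (b : ℝ) ^ 2 := by
    rw [← mul_pow, ← Real.sq_sqrt hk0]
    gcongr
  have hc₁δ : 110 * √5 * Real.pi / 63 ≤ c₁ * δ ^ 2 := by
    rw [div_le_iff₀ (by positivity)] at hc₁ ⊢
    linarith
  have hc₁0 : 0 < c₁ := lt_of_lt_of_le (by positivity) hc₁
  have hsq : 15 * Real.pi ^ 2 ≤ (c₁ * δ ^ 2) ^ 2 := by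
    calc 15 * Real.pi ^ 2 ≤ (110 * √5 * Real.pi / 63) ^ 2 := by
          rw [div_pow, mul_pow, mul_pow, Real.sq_sqrt (by norm_num)]
          linarith [sq_nonneg Real.pi]
      _ ≤ _ := by gcongr
  set y : ℝ := 1 + α ^ 2 * (s : ℝ) ^ 2 with hy
  have hy0 : 0 < y := by positivity
  set A : ℝ := ν * c₁ * s * y / Real.pi with hA
  refine hasUnstableSolution_of_amplitude_ge (A := A) (δ := δ) hν (by positivity) hδ hs ha ?_
    g1 g2 g3 hδk ?_ fun x => ?_
  · have := abs_lt.2 ⟨g5, g6⟩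
    linarith
  · have e : 8 * (δ * (a * A / 2 / ν)) ^ 2 =
        2 * (a : ℝ) ^ 2 * (δ ^ 2 * c₁ ^ 2 * (s : ℝ) ^ 2 * y ^ 2 / Real.pi ^ 2) := by
      rw [hA]
      field_simp
      ring
    rw [e, ← hy]
    have h5 : δ ^ 2 * (s : ℝ) ^ 2 ≤ 2 * (a : ℝ) ^ 2 := by linarith
    calc 15 * ((s : ℝ) ^ 2 * y) ^ 2
        = 15 * Real.pi ^ 2 * ((s : ℝ) ^ 2 * y) ^ 2 / Real.pi ^ 2 := by field_simp
      _ ≤ (c₁ * δ ^ 2) ^ 2 * ((s : ℝ) ^ 2 * y) ^ 2 / Real.pi ^ 2 := by gcongr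
      _ = δ ^ 2 * (s : ℝ) ^ 2 * (δ ^ 2 * c₁ ^ 2 * (s : ℝ) ^ 2 * y ^ 2 / Real.pi ^ 2) := by ring
      _ ≤ _ := by gcongr
  · simp only [u0, v0, amplitude, ← hy, hA]
    field_simp

/-! ### The stationary flow -/

section

variable {C : ℝ} {s : ℕ}

lemma hasDerivAt_sin_profile (z : ℝ) :
    HasDerivAt (fun z : ℝ => C * Real.sin (s * z)) (C * s * Real.cos (s * z)) z := by
  convert! (((hasDerivAt_id z).const_mul (s : ℝ)).sin).const_mul C using 1
  simp only [id]
  ring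

lemma pd_sin_profile (j : Fin 3) (x : E3) :
    pd j (fun y : E3 => C * Real.sin (s * y 2)) x =
      if j = 2 then C * s * Real.cos (s * x 2) else 0 :=
  pd_comp_coord (hasDerivAt_sin_profile _) j

lemma isSmoothOnTorus_sin_profile :
    IsSmoothOnTorus fun x : E3 => C * Real.sin (s * x 2) := by
  refine ⟨by fun_prop, fun j x => ?_⟩
  by_cases hj : j = 2
  · subst hj
    simp only [PiLp.add_apply, PiLp.single_apply, if_true, mul_add]
    rw [Real.sin_add_nat_mul_two_pi]
  · simp [Ne.symm hj]

lemma laplacian_sin_profile (x : E3) :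
    Laplacian.laplacian (fun y : E3 => C * Real.sin (s * y 2)) x =
      -(s : ℝ) ^ 2 * (C * Real.sin (s * x 2)) := by
  rw [laplacian_eq_sum_pd (by fun_prop), Fin.sum_univ_three]
  have h0 : pd 0 (fun y : E3 => C * Real.sin (s * y 2)) = fun _ => 0 :=
    funext fun y => pd_sin_profile 0 y
  have h1 : pd 1 (fun y : E3 => C * Real.sin (s * y 2)) = fun _ => 0 :=
    funext fun y => pd_sin_profile 1 y
  have h2 : pd 2 (fun y : E3 => C * Real.sin (s * y 2)) =
      fun y => C * s * Real.cos (s * y 2) := funext fun y => pd_sin_profile 2 y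
  have h' : HasDerivAt (fun z : ℝ => C * s * Real.cos (s * z))
      (-(s : ℝ) ^ 2 * (C * Real.sin (s * x 2))) (x 2) := by
    convert! (((hasDerivAt_id (x 2)).const_mul (s : ℝ)).cos).const_mul (C * s) using 1
    simp only [id]
    ring
  rw [h0, h1, h2, pd_comp_coord (g := fun z : ℝ => C * s * Real.cos (s * z)) h']
  simp [pd]

end

lemma isStationarySolution_sin (ν α lam : ℝ) (s : ℕ) :
    IsStationarySolution ν α (forcing ν lam s) (alongFirst (v0 ν lam s))
      (alongFirst (u0 ν α lam s)) (fun _ => 0) := by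
  set C : Fin 3 → ℝ := fun j => if j = 0 then 1 / (√2 * Real.pi) * ν * lam else 0 with hC
  have hv : ∀ j, alongFirst (v0 ν lam s) j = fun x => C j * Real.sin (s * x 2) := by
    intro j; funext x; simp only [alongFirst, v0, hC]; split_ifs <;> simp
  have hu : ∀ j, alongFirst (u0 ν α lam s) j =
      fun x => C j / (1 + α ^ 2 * (s : ℝ) ^ 2) * Real.sin (s * x 2) := by
    intro j; funext x; simp only [alongFirst, u0, v0, hC]; split_ifs
    · ring
    · simp
  have hC2 : C 2 = 0 := by simp [hC]
  refine ⟨fun j => ?_, ⟨contDiff_const, fun _ _ => rfl⟩, fun j => ⟨?_, fun x => ?_⟩,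
    fun j x => ?_, fun x => ?_, fun x => ?_⟩
  · rw [hv]; exact isSmoothOnTorus_sin_profile
  · rw [hu]; exact isSmoothOnTorus_sin_profile
  · rw [hu, hv, laplacian_sin_profile, smul_eq_mul]
    have : 1 + α ^ 2 * (s : ℝ) ^ 2 ≠ 0 := by positivity
    field_simp
    ring
  · have hp : pd j (fun _ : E3 => (0 : ℝ)) x = 0 := by simp [pd]
    simp only [hv, hu, laplacian_sin_profile, pd_sin_profile, hp, Fin.sum_univ_three, hC2, forcing]
    simp only [hC]
    split_ifs <;> first | contradiction | (simp; try ring)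
  · simp [hv, pd_sin_profile, hC2]
  · simp [hu, pd_sin_profile, hC2]

/-! ### Counting the unstable wave vectors -/

/-- The sector `{c₃ ≤ |p| ≤ c₄, |p₂| ≤ p₁}` of an annulus. -/
def annularSector (c₃ c₄ : ℝ) : Set (ℝ × ℝ) :=
  {p | c₃ ≤ √(p.1 ^ 2 + p.2 ^ 2) ∧ √(p.1 ^ 2 + p.2 ^ 2) ≤ c₄ ∧ |p.2| ≤ p.1}

lemma measurableSet_annularSector (c₃ c₄ : ℝ) : MeasurableSet (annularSector c₃ c₄) := by
  have h : Measurable fun p : ℝ × ℝ => √(p.1 ^ 2 + p.2 ^ 2) := by fun_prop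
  exact (measurableSet_le measurable_const h).inter ((measurableSet_le h measurable_const).inter
    (measurableSet_le (f := fun p : ℝ × ℝ => |p.2|) (by fun_prop) measurable_fst))

lemma abs_sin_le_cos_iff {θ : ℝ} (hθ : |θ| < Real.pi) :
    |Real.sin θ| ≤ Real.cos θ ↔ |θ| ≤ Real.pi / 4 := by
  have hpi := Real.pi_pos
  rw [Real.abs_sin_eq_sin_abs_of_abs_le_pi hθ.le, ← Real.cos_abs θ]
  set t := |θ|
  have ht : 0 ≤ t := abs_nonneg θ
  have hsin := Real.sin_nonneg_of_nonneg_of_le_pi ht hθ.le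
  have h2 : (√2 / 2) ^ 2 = 1 / 2 := by rw [div_pow, Real.sq_sqrt (by norm_num)]; norm_num
  constructor
  · intro h
    by_contra! h'
    have h1 : Real.cos t < √2 / 2 := by
      rw [← Real.cos_pi_div_four]
      exact Real.cos_lt_cos_of_nonneg_of_le_pi (by positivity) hθ.le h'
    have h3 := Real.sin_sq_add_cos_sq t
    have h4 : Real.cos t ^ 2 < (√2 / 2) ^ 2 := by gcongr; linarith
    have h5 : Real.sin t ^ 2 ≤ Real.cos t ^ 2 := by gcongr
    linarith
  · intro h
    have h1 : Real.sin t ≤ Real.sin (Real.pi / 4) :=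
      Real.sin_le_sin_of_le_of_le_pi_div_two (by linarith) (by linarith) h
    have h3 : Real.cos (Real.pi / 4) ≤ Real.cos t :=
      Real.cos_le_cos_of_nonneg_of_le_pi ht (by linarith) h
    rw [Real.sin_pi_div_four] at h1
    rw [Real.cos_pi_div_four] at h3
    linarith

lemma volume_annularSector {c₃ c₄ : ℝ} (hc₃ : 0 < c₃) (hc₃₄ : c₃ < c₄) :
    volume.real (annularSector c₃ c₄) = Real.pi / 4 * (c₄ ^ 2 - c₃ ^ 2) := by
  have hpi := Real.pi_pos
  have h1 := integral_comp_polarCoord_symm ((annularSector c₃ c₄).indicator fun _ => (1 : ℝ))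
  rw [integral_indicator_const _ (measurableSet_annularSector c₃ c₄), smul_eq_mul, mul_one] at h1
  rw [← h1]
  set B : Set (ℝ × ℝ) := Set.Icc c₃ c₄ ×ˢ Set.Icc (-(Real.pi / 4)) (Real.pi / 4) with hB
  have hBm : MeasurableSet B := measurableSet_Icc.prod measurableSet_Icc
  have hsub : B ⊆ polarCoord.target := by
    rintro ⟨ρ, θ⟩ ⟨⟨h1, h2⟩, h3, h4⟩
    simp only at h1 h2 h3 h4
    exact ⟨hc₃.trans_le h1, by simp only; linarith, by simp only; linarith⟩
  have hmeas : MeasurableSet polarCoord.target := polarCoord.open_target.measurableSet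
  have h2 : ∀ p ∈ polarCoord.target,
      p.1 • (annularSector c₃ c₄).indicator (fun _ => (1 : ℝ)) (polarCoord.symm p) =
        B.indicator (fun p => p.1 * 1) p := by
    rintro ⟨ρ, θ⟩ ⟨hρ, hθ1, hθ2⟩
    simp only [Set.mem_Ioi] at hρ hθ1 hθ2
    have hmem : polarCoord.symm (ρ, θ) ∈ annularSector c₃ c₄ ↔ (ρ, θ) ∈ B := by
      have hsq : √((ρ * Real.cos θ) ^ 2 + (ρ * Real.sin θ) ^ 2) = ρ := by
        rw [mul_pow, mul_pow, ← mul_add, Real.cos_sq_add_sin_sq, mul_one, Real.sqrt_sq hρ.le]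
      simp only [annularSector, polarCoord_symm_apply, Set.mem_ofPred_eq, hsq, hB, Set.mem_prod,
        Set.mem_Icc, and_assoc, abs_mul, abs_of_pos hρ]
      rw [mul_le_mul_iff_right₀ hρ, abs_sin_le_cos_iff (abs_lt.2 ⟨hθ1, hθ2⟩), abs_le]
    by_cases hp : (ρ, θ) ∈ B
    · rw [Set.indicator_of_mem hp, Set.indicator_of_mem (hmem.2 hp), smul_eq_mul]
    · rw [Set.indicator_of_notMem hp, Set.indicator_of_notMem (mt hmem.1 hp), smul_zero]
  rw [setIntegral_congr_fun hmeas h2, setIntegral_indicator hBm, Set.inter_eq_right.2 hsub, hB,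
    Measure.volume_eq_prod, setIntegral_prod_mul (fun x : ℝ => x) (fun _ : ℝ => (1 : ℝ)),
    integral_Icc_eq_integral_Ioc, ← intervalIntegral.integral_of_le hc₃₄.le, integral_id,
    setIntegral_const, Real.volume_real_Icc_of_le (by linarith)]
  simp only [smul_eq_mul]
  ring

/-- The part of the sector in coordinates indexed by `Fin 2` is the difference of two convex sets,
hence has a null frontier. -/
lemma volume_frontier_annularSector (c₃ c₄ : ℝ) :
    volume (frontier {x : Fin 2 → ℝ | (x 0, x 1) ∈ annularSector c₃ c₄}) = 0 := by
  have hconv : ConvexOn ℝ Set.univ fun x : Fin 2 → ℝ => √(x 0 ^ 2 + x 1 ^ 2) := by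
    have h := (convexOn_norm (E := EuclideanSpace ℝ (Fin 2)) convex_univ).comp_linearMap
      (WithLp.linearEquiv 2 ℝ (Fin 2 → ℝ)).symm.toLinearMap
    convert! h using 1
    funext x
    simp [EuclideanSpace.norm_eq, Fin.sum_univ_two]
  have h1 : Convex ℝ {x : Fin 2 → ℝ | √(x 0 ^ 2 + x 1 ^ 2) ≤ c₄} := by
    simpa using hconv.convex_le c₄
  have h2 : Convex ℝ {x : Fin 2 → ℝ | √(x 0 ^ 2 + x 1 ^ 2) < c₃} := by
    simpa using hconv.convex_lt c₃
  have h3 : Convex ℝ {x : Fin 2 → ℝ | |x 1| ≤ x 0} := by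
    intro x hx y hy p q hp hq _
    simp only [Set.mem_ofPred_eq, Pi.add_apply, Pi.smul_apply, smul_eq_mul] at *
    calc |p * x 1 + q * y 1| ≤ p * |x 1| + q * |y 1| := by
          refine (abs_add_le _ _).trans ?_
          rw [abs_mul, abs_mul, abs_of_nonneg hp, abs_of_nonneg hq]
      _ ≤ _ := by gcongr
  have hS : {x : Fin 2 → ℝ | (x 0, x 1) ∈ annularSector c₃ c₄} =
      {x : Fin 2 → ℝ | √(x 0 ^ 2 + x 1 ^ 2) < c₃}ᶜ ∩
        ({x : Fin 2 → ℝ | √(x 0 ^ 2 + x 1 ^ 2) ≤ c₄} ∩ {x : Fin 2 → ℝ | |x 1| ≤ x 0}) := by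
    ext x
    simp [annularSector]
  rw [hS]
  refine measure_mono_null (frontier_inter_subset _ _) (measure_union_null ?_ ?_)
  · refine measure_mono_null Set.inter_subset_left ?_
    rw [frontier_compl]
    exact h2.addHaar_frontier volume
  · exact measure_mono_null Set.inter_subset_right ((h1.inter h3).addHaar_frontier volume)

/-- The lattice points of the sector scaled by `n`. -/
def sectorPoints (c₃ c₄ : ℝ) (n : ℕ) : Set (ℤ × ℤ) :=
  {p | c₃ * n ≤ √((p.1 : ℝ) ^ 2 + (p.2 : ℝ) ^ 2) ∧ √((p.1 : ℝ) ^ 2 + (p.2 : ℝ) ^ 2) ≤ c₄ * n ∧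
    |p.2| ≤ p.1}

lemma finite_sectorPoints (c₃ c₄ : ℝ) (n : ℕ) : (sectorPoints c₃ c₄ n).Finite := by
  have hfin : (Set.Icc (-⌊c₄ * n⌋) ⌊c₄ * n⌋ ×ˢ Set.Icc (-⌊c₄ * n⌋) ⌊c₄ * n⌋ : Set (ℤ × ℤ)).Finite :=
    (Set.finite_Icc _ _).prod (Set.finite_Icc _ _)
  refine hfin.subset ?_
  rintro ⟨a, b⟩ ⟨-, h, -⟩
  simp only at h
  have h1 : |(a : ℝ)| ≤ c₄ * n := (Real.abs_le_sqrt (by nlinarith [sq_nonneg (b : ℝ)])).trans h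
  have h2 : |(b : ℝ)| ≤ c₄ * n := (Real.abs_le_sqrt (by nlinarith [sq_nonneg (a : ℝ)])).trans h
  have h1' : |a| ≤ ⌊c₄ * n⌋ := Int.le_floor.2 (by exact_mod_cast h1)
  have h2' : |b| ≤ ⌊c₄ * n⌋ := Int.le_floor.2 (by exact_mod_cast h2)
  exact ⟨abs_le.1 h1', abs_le.1 h2'⟩

lemma tendsto_ncard_sectorPoints {c₃ c₄ : ℝ} (hc₃ : 0 < c₃) (hc₃₄ : c₃ < c₄) :
    Tendsto (fun n : ℕ => ((sectorPoints c₃ c₄ n).ncard : ℝ) / (n : ℝ) ^ 2) atTop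
      (𝓝 (Real.pi / 4 * (c₄ ^ 2 - c₃ ^ 2))) := by
  set S : Set (Fin 2 → ℝ) := {x | (x 0, x 1) ∈ annularSector c₃ c₄} with hS
  have hSm : MeasurableSet S :=
    (MeasurableEquiv.finTwoArrow (α := ℝ)).measurable (measurableSet_annularSector c₃ c₄)
  have hSb : Bornology.IsBounded S := by
    refine (Metric.isBounded_closedBall (x := (0 : Fin 2 → ℝ)) (r := c₄)).subset ?_
    rintro x ⟨-, h, -⟩
    simp only at h
    rw [mem_closedBall_zero_iff, pi_norm_le_iff_of_nonneg (hc₃.trans hc₃₄).le, Fin.forall_fin_two]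
    exact ⟨(Real.abs_le_sqrt (by nlinarith [sq_nonneg (x 1)])).trans h,
      (Real.abs_le_sqrt (by nlinarith [sq_nonneg (x 0)])).trans h⟩
  have hSv : volume.real S = Real.pi / 4 * (c₄ ^ 2 - c₃ ^ 2) := by
    rw [← volume_annularSector hc₃ hc₃₄]
    exact (volume_preserving_finTwoArrow ℝ).measureReal_preimage
      (measurableSet_annularSector c₃ c₄).nullMeasurableSet
  have key := tendsto_card_div_pow_atTop_volume S hSb hSm (volume_frontier_annularSector c₃ c₄)
  rw [hSv] at key
  refine key.congr' ?_
  filter_upwards [eventually_gt_atTop 0] with n hn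
  have hn' : (0 : ℝ) < n := by exact_mod_cast hn
  have : NeZero n := ⟨hn.ne'⟩
  have hmem := fun v : Fin 2 → ℝ => BoxIntegral.unitPartition.mem_smul_span_iff (n := n) (v := v)
  have hscale : ∀ a b : ℤ, ![(a : ℝ) / n, (b : ℝ) / n] ∈ S ↔ (a, b) ∈ sectorPoints c₃ c₄ n := by
    intro a b
    have h1 : √(((a : ℝ) / n) ^ 2 + ((b : ℝ) / n) ^ 2) = √((a : ℝ) ^ 2 + (b : ℝ) ^ 2) / n := by
      rw [div_pow, div_pow, ← add_div, Real.sqrt_div' _ (by positivity), Real.sqrt_sq hn'.le]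
    simp only [hS, annularSector, sectorPoints, Set.mem_ofPred_eq, Matrix.cons_val_zero,
      Matrix.cons_val_one, h1]
    rw [le_div_iff₀ hn', div_le_iff₀ hn', abs_div, abs_of_pos hn', div_le_div_iff_of_pos_right hn']
    norm_cast
  rw [Fintype.card_fin]
  congr 2
  rw [Nat.card_coe_set_eq]
  symm
  refine Set.ncard_congr (fun p _ => ![(p.1 : ℝ) / n, (p.2 : ℝ) / n]) ?_ ?_ ?_
  · rintro ⟨a, b⟩ ⟨h1, h2, h3⟩
    refine ⟨(hscale a b).2 ⟨h1, h2, h3⟩, (hmem _).2 (Fin.forall_fin_two.2 ⟨⟨a, ?_⟩, ⟨b, ?_⟩⟩)⟩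
    · simp only [Matrix.cons_val_zero, algebraMap_int_eq, eq_intCast]
      field_simp
    · simp only [Matrix.cons_val_one, Matrix.cons_val_zero, algebraMap_int_eq, eq_intCast]
      field_simp
  · rintro ⟨a, b⟩ ⟨a', b'⟩ - - h
    have h0 := congrFun h 0
    have h1 := congrFun h 1
    simp only [Matrix.cons_val_zero, Matrix.cons_val_one] at h0 h1
    rw [div_left_inj' hn'.ne', Int.cast_inj] at h0 h1
    rw [h0, h1]
  · rintro x ⟨hx, hxL⟩
    obtain ⟨⟨a, ha⟩, ⟨b, hb⟩⟩ := Fin.forall_fin_two.1 ((hmem x).1 hxL)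
    simp only [algebraMap_int_eq, eq_intCast] at ha hb
    have e : ![(a : ℝ) / n, (b : ℝ) / n] = x := by
      funext i
      fin_cases i
      · simp [ha, hn'.ne']
      · simp [hb, hn'.ne']
    exact ⟨(a, b), (hscale a b).1 (by rw [e]; exact hx), e⟩

lemma triples_eq_image (c₂ c₃ c₄ : ℝ) (s : ℕ) :
    triples c₂ c₃ c₄ s = Equiv.prodAssoc ℤ ℤ ℤ ''
      (sectorPoints c₃ c₄ s ×ˢ Set.Icc (-⌊c₂ * s⌋) ⌊c₂ * s⌋) := by
  ext ⟨a, b, r⟩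
  have h : |(r : ℝ)| ≤ c₂ * s ↔ r ∈ Set.Icc (-⌊c₂ * s⌋) ⌊c₂ * s⌋ := by
    rw [Set.mem_Icc, ← abs_le, Int.le_floor]
    push_cast
    rfl
  rw [Equiv.image_eq_preimage_symm]
  simp only [triples, sectorPoints, Set.mem_ofPred_eq, Set.mem_preimage, Set.mem_prod, ← h,
    Equiv.prodAssoc_symm_apply]
  tauto

lemma finite_triples (c₂ c₃ c₄ : ℝ) (s : ℕ) : (triples c₂ c₃ c₄ s).Finite := by
  rw [triples_eq_image]
  exact ((finite_sectorPoints c₃ c₄ s).prod (Set.finite_Icc _ _)).image _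

lemma tendsto_ncard_triples {c₂ c₃ c₄ : ℝ} (hc₂ : 0 < c₂) (hc₃ : 0 < c₃) (hc₃₄ : c₃ < c₄) :
    Tendsto (fun s : ℕ => ((triples c₂ c₃ c₄ s).ncard : ℝ) / (s : ℝ) ^ 3) atTop
      (𝓝 (2 * (1 / 4 * Real.pi * c₂ * (c₄ ^ 2 - c₃ ^ 2)))) := by
  have h1 := tendsto_ncard_sectorPoints hc₃ hc₃₄
  have h2 : Tendsto (fun s : ℕ => (2 * (⌊c₂ * (s : ℝ)⌋₊ : ℝ) + 1) / s) atTop (𝓝 (2 * c₂ + 0)) := by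
    have h3 := ((tendsto_nat_floor_mul_div_atTop hc₂.le).comp
      (tendsto_natCast_atTop_atTop (R := ℝ))).const_mul 2
    refine (h3.add (tendsto_const_div_atTop_nhds_zero_nat 1)).congr fun s => ?_
    simp only [Function.comp]
    ring
  have h3 := h1.mul h2
  rw [show Real.pi / 4 * (c₄ ^ 2 - c₃ ^ 2) * (2 * c₂ + 0) =
    2 * (1 / 4 * Real.pi * c₂ * (c₄ ^ 2 - c₃ ^ 2)) by ring] at h3
  refine h3.congr fun s => ?_
  have hcard : (Set.Icc (-⌊c₂ * (s : ℝ)⌋) ⌊c₂ * (s : ℝ)⌋).ncard = 2 * ⌊c₂ * (s : ℝ)⌋₊ + 1 := by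
    have h0 : 0 ≤ ⌊c₂ * (s : ℝ)⌋ := Int.floor_nonneg.2 (by positivity)
    rw [← Finset.coe_Icc, Set.ncard_coe_finset, Int.card_Icc, ← Int.floor_toNat]
    omega
  rw [triples_eq_image, Set.ncard_image_of_injective _ (Equiv.injective _), Set.ncard_prod, hcard]
  push_cast
  rw [div_mul_div_comm]
  ring

end ModifiedLerayAlpha

theorem mainTheorem5 (δ c₁ c₂ c₃ c₄ : ℝ)
    (hδ : 0 < δ) (hδ' : δ < 1 / √3)
    (hc₁ : 110 * √5 * Real.pi / (63 * δ ^ 2) ≤ c₁)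
    (hc₂ : 0 < c₂) (hc₃ : 0 < c₃) (hc₃₄ : c₃ < c₄)
    (hD : ∀ s : ℝ, 0 < s →
      ModifiedLerayAlpha.rectD c₂ c₃ c₄ s ⊆ ModifiedLerayAlpha.regionA δ s) :
    (∀ (ν α : ℝ) (s : ℕ), 0 < ν → 0 ≤ α → 0 < s →
      ModifiedLerayAlpha.IsStationarySolution ν α
        (ModifiedLerayAlpha.forcing ν (ModifiedLerayAlpha.amplitude c₁ α s) s)
        (ModifiedLerayAlpha.alongFirst
          (ModifiedLerayAlpha.v0 ν (ModifiedLerayAlpha.amplitude c₁ α s) s))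
        (ModifiedLerayAlpha.alongFirst
          (ModifiedLerayAlpha.u0 ν α (ModifiedLerayAlpha.amplitude c₁ α s) s))
        (fun _ => 0) ∧
      ∀ a b r : ℤ, (a, b, r) ∈ ModifiedLerayAlpha.triples c₂ c₃ c₄ s →
        ModifiedLerayAlpha.HasUnstableSolution ν α
          (ModifiedLerayAlpha.u0 ν α (ModifiedLerayAlpha.amplitude c₁ α s) s) s a b r) ∧
    (∀ s : ℕ, (ModifiedLerayAlpha.triples c₂ c₃ c₄ s).Finite) ∧
    Tendsto (fun s : ℕ => ((ModifiedLerayAlpha.triples c₂ c₃ c₄ s).ncard : ℝ) / (s : ℝ) ^ 3) atTop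
      (𝓝 (2 * (1 / 4 * Real.pi * c₂ * (c₄ ^ 2 - c₃ ^ 2)))) := by
  refine ⟨fun ν α s hν _ hs =>
    ⟨ModifiedLerayAlpha.isStationarySolution_sin ν α _ s, fun a b r h => ?_⟩,
    ModifiedLerayAlpha.finite_triples c₂ c₃ c₄,
    ModifiedLerayAlpha.tendsto_ncard_triples hc₂ hc₃ hc₃₄⟩
  exact ModifiedLerayAlpha.hasUnstableSolution_of_mem_triples hδ hc₁ hc₃
    (hD s (by exact_mod_cast hs)) hν hs h
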